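/- Let $K$ be an algebraically closed field of characteristic $0$, let $p\ge 2$ and $m\ge 1$ be integers, and consider the $p$-Mahler equation $$a_m(z)f(z^{p^m})+\cdots+a_1(z)f(z^p)+a_0(z)f(z)=0,\qquad a_0,\dots,a_m\in\bigcup_{d\ge1}K((z^{1/d})),\quad a_0a_m\neq 0 .\tag{$*$}$$ **Rings.** For a commutative ring $R$ let $\mathscr H_R$ be the ring of Hahn series $f=\sum_{\gamma\in\mathbb Q}f_\gamma z^\gamma$ with $f_\gamma\in R$ and well-ordered support, $\operatorname{val}_z f$ the least element of the support, $\operatorname{cld}_z f=f_{\operatorname{val}_z f}$, and $\phi_p(f)(z)=f(z^p)$. Let $$\mathscr R=\mathscr H_K[(X_c)_{c\in K^\times},Y]/(X_1-1,\;X_cX_d-X_{cd}),$$ denote by $e_c,\ell$ the classes of $X_c,Y$, and extend $\phi_p$ to $\mathscr R$ by $\phi_p(e_c)=c\,e_c$, $\phi_p(\ell)=\ell+1$. For $c\in K^\times$ let $K[[\lambda-c]]^{\rm rat}\subset K(\lambda)$ be the ring of rational functions without pole at $c$. On the polynomial ring $\mathscr H_{K[[\lambda-c]]^{\rm rat}}[e_\lambda,\partial_\lambda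 e_\lambda,\partial_\lambda^2e_\lambda,\dots]$ (the $\partial_\lambda^k e_\lambda$ are indeterminates) let $\partial_\lambda$ be the derivation acting coefficientwise on Hahn series and sending $\partial_\lambda^k e_\lambda$ to $\partial_\lambda^{k+1}e_\lambda$; let $\phi_p$ extend $f(z)\mapsto f(z^p)$, fix $\lambda$, commute with $\partial_\lambda$ and satisfy $\phi_p(e_\lambda)=\lambda e_\lambda$; and let $\operatorname{ev}_{\lambda=c}$ be the ring homomorphism to $\mathscr R$ that evaluates coefficients at $\lambda=c$ and sends $\partial_\lambda^ke_\lambda$ to $c^{-k}\,\ell(\ell-1)\cdots(\ell-k+1)\,e_c$. On both rings put $L=\sum_{i=0}^m a_i\phi_p^i$. **Slopes and exponents.** The Newton polygon of $(*)$ is the convex hull of $\{(p^i,y): 0\le i\le m,\ a_i\ne0,\ y\ge\operatorname{val}_z a_i\}\subset\mathbb R^2$; let $\mu_1<\cdots<\mu_\kappa$ be the slopes of its non-vertical edges. Let $\chi_j(\lambda)=\sum_i \operatorname{cld}_z(a_i)\lambda^i$, the sum over the $i$ such that $a_i\neq0$ and $(p^i,\operatorname{val}_z a_i)$ lies on the edge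 of slope $\mu_j$. The nonzero roots $c$ of $\chi_j$ are the exponents attached to $\mu_j$; let $m_{c,j}$ be the multiplicity of $c\in K^\times$ as a root of $\chi_j$ ($0$ if $c$ is not a root), and $s_{c,j}=m_{c,1}+\cdots+m_{c,j-1}$. **Theorem.** Assume that for every $j$ and every exponent $c$ attached to $\mu_j$ we are given $h_{c,j}\in\mathscr H_{K[[\lambda-c]]^{\rm rat}}$ such that $\operatorname{val}_z h_{c,j}=-\mu_j$, the $(\lambda-c)$-adic valuation of $\operatorname{cld}_z h_{c,j}$ is $s_{c,j}$, and $$L(h_{c,j}e_\lambda)\in(\lambda-c)^{s_{c,j}+m_{c,j}}\,e_\lambda\,\mathscr H_{K[[\lambda-c]]^{\rm rat}} .$$ Then the elements $$y_{c,j,i}=\operatorname{ev}_{\lambda=c}\!\big(\partial_\lambda^{\,s_{c,j}+i}(h_{c,j}e_\lambda)\big)\in\mathscr R,$$ where $1\le j\le\kappa$, $c$ is an exponent attached to $\mu_j$ and $0\le i<m_{c,j}$, form a basis of solutions of $(*)$: there are exactly $m$ of these triples $(c,j,i)$, and the family $(y_{c,j,i})$ is a basis of the $K$-vector space $\{y\in\mathscr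 R: Ly=0\}$. -/

import Mathlib

noncomputable section

namespace MahlerFrobenius

/-! ### Hahn series, Puiseux series and the operator `z ↦ z ^ p`

The ring of Hahn series in `z` with rational exponents and coefficients in `R` is
`HahnSeries ℚ R`; the valuation of `f` is `f.orderTop` (`f.order` if `f ≠ 0`) and its coefficient
of lowest degree is `f.leadingCoeff`. -/

/-- Puiseux series: the Hahn series whose exponents have a common denominator. -/
def IsPuiseux {R : Type*} [Zero R] (f : HahnSeries ℚ R) : Prop :=
  ∃ d : ℕ, 0 < d ∧ ∀ γ ∈ f.support, ∃ n : ℤ, γ = (n : ℚ) / (d : ℚ)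

theorem mulLeft_injective (p : ℕ) (hp : 2 ≤ p) :
    Function.Injective (AddMonoidHom.mulLeft (p : ℚ)) := by
  intro x y hxy
  have h0 : (p : ℚ) ≠ 0 := Nat.cast_ne_zero.2 (by omega)
  simpa [h0] using hxy

theorem mulLeft_le_iff (p : ℕ) (hp : 2 ≤ p) (x y : ℚ) :
    AddMonoidHom.mulLeft (p : ℚ) x ≤ AddMonoidHom.mulLeft (p : ℚ) y ↔ x ≤ y := by
  have h0 : (0 : ℚ) < p := Nat.cast_pos.2 (by omega)
  simp [h0]

/-- The operator `f(z) ↦ f(z ^ p)` on Hahn series. -/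
def mahler (p : ℕ) (hp : 2 ≤ p) (R : Type*) [CommRing R] :
    HahnSeries ℚ R →+* HahnSeries ℚ R :=
  HahnSeries.embDomainRingHom (AddMonoidHom.mulLeft (p : ℚ))
    (mulLeft_injective p hp) (mulLeft_le_iff p hp)

/-- The ring homomorphism between rings of Hahn series that applies `f` to every coefficient. -/
def hahnMap {R S : Type*} [CommRing R] [CommRing S] (f : R →+* S) :
    HahnSeries ℚ R →+* HahnSeries ℚ S where
  toFun x := x.map f
  map_zero' := by ext; simp
  map_one' := by ext; simp [HahnSeries.coeff_one, apply_ite f]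
  map_add' x y := by ext; simp
  map_mul' x y := HahnSeries.map_mul (f : R →ₙ+* S)

/-- The operator `y ↦ a_m φ^m(y) + ⋯ + a_1 φ(y) + a_0 y` on a ring `S` with an endomorphism `φ`;
the coefficients act on `S` through `ι`. -/
def mahlerOp {R S : Type*} [CommRing R] [CommRing S] {m : ℕ} (ι : HahnSeries ℚ R →+* S)
    (φ : S →+* S) (a : Fin (m + 1) → HahnSeries ℚ R) (y : S) : S :=
  ∑ i : Fin (m + 1), ι (a i) * φ^[(i : ℕ)] y

/-! ### The ring `𝓡 = 𝓗[(e_c)_c, ℓ]` -/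

/-- The ideal spanned by `X_1 - 1` and by the `X_c X_d - X_{cd}`. Here `X_c` is the indeterminate
`some c` and `Y` is the indeterminate `none`. -/
def relIdeal (K : Type*) [Field K] : Ideal (MvPolynomial (Option Kˣ) (HahnSeries ℚ K)) :=
  Ideal.span ({MvPolynomial.X (some 1) - 1} ∪
    Set.range (fun cd : Kˣ × Kˣ => MvPolynomial.X (some cd.1) * MvPolynomial.X (some cd.2)
      - MvPolynomial.X (some (cd.1 * cd.2))))

/-- The ring `𝓡 = 𝓗[(X_c)_c, Y] / (X_1 - 1, X_c X_d - X_{cd})`. -/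
def SolRing (K : Type*) [Field K] : Type _ :=
  MvPolynomial (Option Kˣ) (HahnSeries ℚ K) ⧸ relIdeal K

instance (K : Type*) [Field K] : CommRing (SolRing K) :=
  inferInstanceAs (CommRing (MvPolynomial (Option Kˣ) (HahnSeries ℚ K) ⧸ relIdeal K))

/-- The quotient map. -/
def toSolRing (K : Type*) [Field K] :
    MvPolynomial (Option Kˣ) (HahnSeries ℚ K) →+* SolRing K :=
  Ideal.Quotient.mk (relIdeal K)

/-- The canonical map `𝓗 → 𝓡`. -/
def hahnToSolRing (K : Type*) [Field K] : HahnSeries ℚ K →+* SolRing K :=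
  (toSolRing K).comp MvPolynomial.C

/-- `𝓡` is an algebra over `K` through the constants `K ⊆ 𝓗 → 𝓡`. -/
instance (K : Type*) [Field K] : Algebra K (SolRing K) :=
  ((hahnToSolRing K).comp HahnSeries.C).toAlgebra

/-- The class `e_c` of `X_c`. -/
def eConst {K : Type*} [Field K] (c : Kˣ) : SolRing K :=
  toSolRing K (MvPolynomial.X (some c))

/-- The class `ℓ` of `Y`. -/
def ell (K : Type*) [Field K] : SolRing K :=
  toSolRing K (MvPolynomial.X none)

/-- The endomorphism of `𝓗[(X_c)_c, Y]` that extends `f(z) ↦ f(z ^ p)` and sends `X_c` to `c X_c`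
and `Y` to `Y + 1`. -/
def phiPoly (p : ℕ) (hp : 2 ≤ p) (K : Type*) [Field K] :
    MvPolynomial (Option Kˣ) (HahnSeries ℚ K) →+* MvPolynomial (Option Kˣ) (HahnSeries ℚ K) :=
  MvPolynomial.eval₂Hom (MvPolynomial.C.comp (mahler p hp K)) (fun v =>
    match v with
    | some c => MvPolynomial.C (HahnSeries.C (c : K)) * MvPolynomial.X (some c)
    | none => MvPolynomial.X none + 1)

theorem relIdeal_le_comap (p : ℕ) (hp : 2 ≤ p) (K : Type*) [Field K] :
    relIdeal K ≤ (relIdeal K).comap (phiPoly p hp K) := by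
  have hX : ∀ c : Kˣ, phiPoly p hp K (MvPolynomial.X (some c))
      = MvPolynomial.C (HahnSeries.C (c : K)) * MvPolynomial.X (some c) := fun c => by
    simp [phiPoly]
  refine Ideal.span_le.2 ?_
  rintro x (hx | ⟨⟨c, d⟩, rfl⟩)
  · rw [Set.mem_singleton_iff] at hx
    subst hx
    have h1 : phiPoly p hp K (MvPolynomial.X (some 1) - 1) = MvPolynomial.X (some 1) - 1 := by
      rw [map_sub, hX, map_one]
      simp
    change phiPoly p hp K _ ∈ relIdeal K
    rw [h1]
    exact Ideal.subset_span (Or.inl rfl)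
  · have h1 : phiPoly p hp K (MvPolynomial.X (some c) * MvPolynomial.X (some d)
        - MvPolynomial.X (some (c * d)))
        = MvPolynomial.C (HahnSeries.C ((c * d : Kˣ) : K)) *
          (MvPolynomial.X (some c) * MvPolynomial.X (some d)
            - MvPolynomial.X (some (c * d))) := by
      rw [map_sub, map_mul, hX, hX, hX, Units.val_mul, map_mul, map_mul]
      ring
    change phiPoly p hp K (MvPolynomial.X (some c) * MvPolynomial.X (some d)
        - MvPolynomial.X (some (c * d))) ∈ relIdeal K
    rw [h1]
    exact Ideal.mul_mem_left _ _ (Ideal.subset_span (Or.inr ⟨(c, d), rfl⟩))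

/-- The endomorphism `φ_p` of `𝓡`: it extends `f(z) ↦ f(z ^ p)`, and `φ_p(e_c) = c e_c`,
`φ_p(ℓ) = ℓ + 1`. -/
def phi (p : ℕ) (hp : 2 ≤ p) (K : Type*) [Field K] : SolRing K →+* SolRing K :=
  Ideal.quotientMap (relIdeal K) (phiPoly p hp K) (relIdeal_le_comap p hp K)

/-- The `K`-vector space of the solutions in `𝓡` of
`a_m(z) f(z^{p^m}) + ⋯ + a_1(z) f(z^p) + a_0(z) f(z) = 0`. -/
def solutions (p : ℕ) (hp : 2 ≤ p) {K : Type*} [Field K] {m : ℕ}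
    (a : Fin (m + 1) → HahnSeries ℚ K) : Submodule K (SolRing K) where
  carrier := {y | mahlerOp (hahnToSolRing K) (phi p hp K) a y = 0}
  zero_mem' := by simp [mahlerOp]
  add_mem' {x y} hx hy := by
    simp only [mahlerOp, Set.mem_ofPred_eq] at hx hy ⊢
    simp only [iterate_map_add, mul_add, Finset.sum_add_distrib, hx, hy, add_zero]
  smul_mem' r x hx := by
    have hr : phi p hp K (algebraMap K (SolRing K) r) = algebraMap K (SolRing K) r := by
      change toSolRing K (phiPoly p hp K (MvPolynomial.C (HahnSeries.C r)))
        = toSolRing K (MvPolynomial.C (HahnSeries.C r))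
      rw [phiPoly, MvPolynomial.eval₂Hom_C, RingHom.comp_apply, mahler,
        HahnSeries.embDomainRingHom_C]
    have hr' : ∀ i : ℕ, (phi p hp K)^[i] (algebraMap K (SolRing K) r)
        = algebraMap K (SolRing K) r := fun i => Function.iterate_fixed hr i
    simp only [mahlerOp, Set.mem_ofPred_eq] at hx ⊢
    simp only [Algebra.smul_def, iterate_map_mul, hr', mul_left_comm _ (algebraMap K (SolRing K) r)]
    rw [← Finset.mul_sum, hx, mul_zero]

/-! ### Rational functions of `λ` without pole at `c` -/

theorem regular_iff {K : Type*} [Field K] (c : K) (f : RatFunc K) :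
    f.denom.eval c ≠ 0 ↔ ∃ n q : Polynomial K, q.eval c ≠ 0 ∧
      f = algebraMap (Polynomial K) (RatFunc K) n / algebraMap (Polynomial K) (RatFunc K) q := by
  constructor
  · intro h
    exact ⟨f.num, f.denom, h, (RatFunc.num_div_denom f).symm⟩
  · rintro ⟨n, q, hq, rfl⟩ h0
    have hq0 : q ≠ 0 := by rintro rfl; simp at hq
    exact hq (Polynomial.eval_eq_zero_of_dvd_of_eval_eq_zero (RatFunc.denom_div_dvd n q) h0)

/-- The ring `K[[λ - c]]^rat` of the rational functions of `λ` that have no pole at `c`. -/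
def regularAt {K : Type*} [Field K] (c : K) : Subalgebra K (RatFunc K) where
  carrier := {f | f.denom.eval c ≠ 0}
  mul_mem' {f g} hf hg h0 := by
    have := Polynomial.eval_eq_zero_of_dvd_of_eval_eq_zero (RatFunc.denom_mul_dvd f g) h0
    rw [Polynomial.eval_mul] at this
    exact (mul_ne_zero hf hg) this
  add_mem' {f g} hf hg h0 := by
    have := Polynomial.eval_eq_zero_of_dvd_of_eval_eq_zero (RatFunc.denom_add_dvd f g) h0
    rw [Polynomial.eval_mul] at this
    exact (mul_ne_zero hf hg) this
  algebraMap_mem' r := by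
    simp

/-- The element `λ`. -/
def lam {K : Type*} [Field K] (c : K) : regularAt c :=
  ⟨RatFunc.X, by change (RatFunc.X : RatFunc K).denom.eval c ≠ 0; simp⟩

theorem denom_ne {K : Type*} [Field K] {c : K} (f : regularAt c) :
    Polynomial.eval₂ (RingHom.id K) c (f : RatFunc K).denom ≠ 0 :=
  f.2

/-- The value at `λ = c`. -/
def evalAt {K : Type*} [Field K] (c : K) : regularAt c →+* K where
  toFun f := RatFunc.eval (RingHom.id K) c (f : RatFunc K)
  map_zero' := RatFunc.eval_zero ..
  map_one' := RatFunc.eval_one ..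
  map_add' f g := RatFunc.eval_add (f := RingHom.id K) (a := c) (denom_ne f) (denom_ne g)
  map_mul' f g := RatFunc.eval_mul (f := RingHom.id K) (a := c) (denom_ne f) (denom_ne g)

/-- The derivative of a rational function, by the quotient rule. -/
def ratDeriv {K : Type*} [Field K] (f : RatFunc K) : RatFunc K :=
  algebraMap (Polynomial K) (RatFunc K)
      (f.num.derivative * f.denom - f.num * f.denom.derivative) /
    algebraMap (Polynomial K) (RatFunc K) (f.denom ^ 2)

theorem ratDeriv_div {K : Type*} [Field K] (n q : Polynomial K) (hq : q ≠ 0) :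
    ratDeriv (algebraMap (Polynomial K) (RatFunc K) n / algebraMap (Polynomial K) (RatFunc K) q)
      = algebraMap (Polynomial K) (RatFunc K) (n.derivative * q - n * q.derivative) /
        algebraMap (Polynomial K) (RatFunc K) (q ^ 2) := by
  set f := algebraMap (Polynomial K) (RatFunc K) n / algebraMap (Polynomial K) (RatFunc K) q
    with hf
  have hd : f.denom ≠ 0 := RatFunc.denom_ne_zero f
  have inj := RatFunc.algebraMap_injective K
  have hne : ∀ r : Polynomial K, r ≠ 0 → algebraMap (Polynomial K) (RatFunc K) r ≠ 0 :=
    fun r hr => RatFunc.algebraMap_ne_zero hr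
  have key : f.num * q = n * f.denom := by
    have h1 : algebraMap (Polynomial K) (RatFunc K) f.num /
        algebraMap (Polynomial K) (RatFunc K) f.denom =
        algebraMap (Polynomial K) (RatFunc K) n / algebraMap (Polynomial K) (RatFunc K) q := by
      rw [RatFunc.num_div_denom]
    rw [div_eq_div_iff (hne _ hd) (hne _ hq), ← map_mul, ← map_mul] at h1
    exact inj h1
  have key' := congrArg Polynomial.derivative key
  rw [Polynomial.derivative_mul, Polynomial.derivative_mul] at key'
  rw [ratDeriv, div_eq_div_iff (hne _ (pow_ne_zero 2 hd)) (hne _ (pow_ne_zero 2 hq)),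
    ← map_mul, ← map_mul]
  congr 1
  linear_combination (f.denom * q) * key' -
    (q * f.denom.derivative + f.denom * q.derivative) * key

theorem ratDeriv_add {K : Type*} [Field K] (f g : RatFunc K) :
    ratDeriv (f + g) = ratDeriv f + ratDeriv g := by
  obtain ⟨n, q, hq0, rfl⟩ : ∃ n q : Polynomial K, q ≠ 0 ∧
      f = algebraMap (Polynomial K) (RatFunc K) n / algebraMap (Polynomial K) (RatFunc K) q :=
    ⟨f.num, f.denom, f.denom_ne_zero, (RatFunc.num_div_denom f).symm⟩
  obtain ⟨n', q', hq0', rfl⟩ : ∃ n q : Polynomial K, q ≠ 0 ∧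
      g = algebraMap (Polynomial K) (RatFunc K) n / algebraMap (Polynomial K) (RatFunc K) q :=
    ⟨g.num, g.denom, g.denom_ne_zero, (RatFunc.num_div_denom g).symm⟩
  have h1 := RatFunc.algebraMap_ne_zero hq0
  have h1' := RatFunc.algebraMap_ne_zero hq0'
  rw [div_add_div _ _ h1 h1', ← map_mul, ← map_mul, ← map_mul, ← map_add,
    ratDeriv_div _ _ (mul_ne_zero hq0 hq0'), ratDeriv_div _ _ hq0, ratDeriv_div _ _ hq0']
  simp only [Polynomial.derivative_mul, map_mul, map_add, map_sub, map_pow]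
  field_simp
  ring

theorem ratDeriv_mul {K : Type*} [Field K] (f g : RatFunc K) :
    ratDeriv (f * g) = f * ratDeriv g + g * ratDeriv f := by
  obtain ⟨n, q, hq0, rfl⟩ : ∃ n q : Polynomial K, q ≠ 0 ∧
      f = algebraMap (Polynomial K) (RatFunc K) n / algebraMap (Polynomial K) (RatFunc K) q :=
    ⟨f.num, f.denom, f.denom_ne_zero, (RatFunc.num_div_denom f).symm⟩
  obtain ⟨n', q', hq0', rfl⟩ : ∃ n q : Polynomial K, q ≠ 0 ∧
      g = algebraMap (Polynomial K) (RatFunc K) n / algebraMap (Polynomial K) (RatFunc K) q :=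
    ⟨g.num, g.denom, g.denom_ne_zero, (RatFunc.num_div_denom g).symm⟩
  have h1 := RatFunc.algebraMap_ne_zero hq0
  have h1' := RatFunc.algebraMap_ne_zero hq0'
  rw [div_mul_div_comm, ← map_mul, ← map_mul,
    ratDeriv_div _ _ (mul_ne_zero hq0 hq0'), ratDeriv_div _ _ hq0, ratDeriv_div _ _ hq0']
  simp only [Polynomial.derivative_mul, map_mul, map_add, map_sub, map_pow]
  field_simp
  ring

theorem ratDeriv_algebraMap {K : Type*} [Field K] (n : Polynomial K) :
    ratDeriv (algebraMap (Polynomial K) (RatFunc K) n)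
      = algebraMap (Polynomial K) (RatFunc K) n.derivative := by
  have := ratDeriv_div n 1 one_ne_zero
  simpa using this

theorem ratDeriv_smul {K : Type*} [Field K] (r : K) (f : RatFunc K) :
    ratDeriv (r • f) = r • ratDeriv f := by
  have e : ∀ x : RatFunc K, r • x
      = algebraMap (Polynomial K) (RatFunc K) (Polynomial.C r) * x := fun x => by
    rw [RatFunc.algebraMap_C, RatFunc.smul_eq_C_mul]
  rw [e, e, ratDeriv_mul, ratDeriv_algebraMap]
  simp

/-- The derivation `∂ / ∂λ` of `K[[λ - c]]^rat`. -/
def derivAt {K : Type*} [Field K] (c : K) : Derivation K (regularAt c) (regularAt c) :=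
  Derivation.mk'
    { toFun := fun f => ⟨ratDeriv (f : RatFunc K), by
        refine (regular_iff c _).2 ⟨_, _, ?_, rfl⟩
        rw [Polynomial.eval_pow]
        exact pow_ne_zero 2 f.2⟩
      map_add' := fun f g => Subtype.ext (ratDeriv_add (f : RatFunc K) g)
      map_smul' := fun r f => Subtype.ext (ratDeriv_smul r (f : RatFunc K)) }
    (fun f g => Subtype.ext (ratDeriv_mul (f : RatFunc K) g))

/-! ### The ring `𝓗_{K[[λ - c]]^rat}[e_λ, ∂_λ e_λ, ∂_λ² e_λ, …]` -/

/-- The subring `𝓗_{K[[λ - c]]^rat}[e_λ, ∂_λ e_λ, …]` of `𝓡_λ = 𝓗_{K(λ)}[e_λ, ∂_λ e_λ, …]`, on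
which the specialisation at `λ = c` is defined. The indeterminate `X k` is `∂_λ^k e_λ`. -/
abbrev LamRing {K : Type*} [Field K] (c : K) : Type _ :=
  MvPolynomial ℕ (HahnSeries ℚ (regularAt c))

/-- `φ_p` on this ring: it extends `f(z) ↦ f(z ^ p)`, fixes `λ`, commutes with `∂_λ`, and
`φ_p(e_λ) = λ e_λ`; hence `φ_p(∂_λ^k e_λ) = ∂_λ^k (λ e_λ) = λ ∂_λ^k e_λ + k ∂_λ^(k-1) e_λ`
(for `k = 0` the second term vanishes). -/
def phiLam (p : ℕ) (hp : 2 ≤ p) {K : Type*} [Field K] (c : K) : LamRing c →+* LamRing c :=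
  MvPolynomial.eval₂Hom (MvPolynomial.C.comp (mahler p hp (regularAt c))) (fun k =>
    MvPolynomial.C (HahnSeries.C (lam c)) * MvPolynomial.X k
      + (k : LamRing c) * MvPolynomial.X (k - 1))

/-- The derivation `∂_λ` of this ring: it acts on the coefficients of the Hahn series, and sends
`∂_λ^k e_λ` to `∂_λ^(k+1) e_λ`. -/
def dLam {K : Type*} [Field K] (c : K) (y : LamRing c) : LamRing c :=
  (∑ s ∈ y.support, MvPolynomial.monomial s ((y.coeff s).map (derivAt c))) +
    MvPolynomial.mkDerivation (HahnSeries ℚ (regularAt c))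
      (fun k : ℕ => (MvPolynomial.X (k + 1) : LamRing c)) y

/-- The specialisation at `λ = c`, with values in `𝓡`: it evaluates the coefficients of the Hahn
series at `λ = c` and sends `∂_λ^k e_λ` to `c^(-k) ℓ (ℓ - 1) ⋯ (ℓ - k + 1) e_c`. -/
def ev {K : Type*} [Field K] (c : Kˣ) : LamRing (c : K) →+* SolRing K :=
  MvPolynomial.eval₂Hom
    ((hahnToSolRing K).comp (hahnMap (evalAt (c : K)))) (fun k =>
      algebraMap K (SolRing K) (((c : K) ^ k)⁻¹) *
        (∏ i ∈ Finset.range k, (ell K - (i : SolRing K))) * eConst c)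

/-- The operator `L` on this ring. -/
def opLam (p : ℕ) (hp : 2 ≤ p) {K : Type*} [Field K] {m : ℕ}
    (a : Fin (m + 1) → HahnSeries ℚ K) (c : K) : LamRing c → LamRing c :=
  mahlerOp (MvPolynomial.C.comp (hahnMap (algebraMap K (regularAt c)))) (phiLam p hp c) a

/-- `f(λ, z) e_λ` -/
def timesE {K : Type*} [Field K] {c : K} (f : HahnSeries ℚ (regularAt c)) : LamRing c :=
  MvPolynomial.C f * MvPolynomial.X 0

/-! ### Newton polygon, slopes and exponents -/

/-- The set of the points `(p ^ i, y)` with `y ≥ val a_i`, where `val 0 = +∞`. -/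
def newtonPoints (p : ℕ) {K : Type*} [Zero K] {m : ℕ} (a : Fin (m + 1) → HahnSeries ℚ K) :
    Set (ℝ × ℝ) :=
  {P | ∃ i : Fin (m + 1), a i ≠ 0 ∧ P.1 = (p : ℝ) ^ (i : ℕ) ∧ ((a i).order : ℝ) ≤ P.2}

/-- The Newton polygon. -/
def newtonPolygon (p : ℕ) {K : Type*} [Zero K] {m : ℕ} (a : Fin (m + 1) → HahnSeries ℚ K) :
    Set (ℝ × ℝ) :=
  convexHull ℝ (newtonPoints p a)

/-- The intersection of the Newton polygon with its supporting line (from below) of slope `μ`. -/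
def edge (p : ℕ) {K : Type*} [Zero K] {m : ℕ} (a : Fin (m + 1) → HahnSeries ℚ K) (μ : ℚ) :
    Set (ℝ × ℝ) :=
  {P ∈ newtonPolygon p a | ∀ Q ∈ newtonPolygon p a, P.2 - (μ : ℝ) * P.1 ≤ Q.2 - (μ : ℝ) * Q.1}

/-- `μ` is a slope: the Newton polygon has a nondegenerate edge of slope `μ`. -/
def IsSlope (p : ℕ) {K : Type*} [Zero K] {m : ℕ} (a : Fin (m + 1) → HahnSeries ℚ K)
    (μ : ℚ) : Prop :=
  (edge p a μ).Nontrivial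

theorem finite_slopes (p : ℕ) (hp : 2 ≤ p) {K : Type*} [Zero K] {m : ℕ}
    (a : Fin (m + 1) → HahnSeries ℚ K) : {μ : ℚ | IsSlope p a μ}.Finite := by
  classical
  refine (Set.finite_range (fun ij : Fin (m + 1) × Fin (m + 1) =>
    ((a ij.2).order - (a ij.1).order) / ((p : ℚ) ^ (ij.2 : ℕ) - (p : ℚ) ^ (ij.1 : ℕ)))).subset ?_
  intro μ hμ
  by_contra hcon
  have hne : ∀ i j : Fin (m + 1), i ≠ j →
      ((a i).order : ℝ) - μ * (p : ℝ) ^ (i : ℕ) ≠ ((a j).order : ℝ) - μ * (p : ℝ) ^ (j : ℕ) := by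
    intro i j hij h
    apply hcon
    refine ⟨(i, j), ?_⟩
    have h' : (a i).order - μ * (p : ℚ) ^ (i : ℕ) = (a j).order - μ * (p : ℚ) ^ (j : ℕ) := by
      exact_mod_cast h
    have hpow : (p : ℚ) ^ (j : ℕ) - (p : ℚ) ^ (i : ℕ) ≠ 0 := by
      intro h0
      have h1 : p ^ (j : ℕ) = p ^ (i : ℕ) := by exact_mod_cast sub_eq_zero.1 h0
      exact hij (Fin.ext (Nat.pow_right_injective hp h1)).symm
    change ((a j).order - (a i).order) / _ = μ
    rw [div_eq_iff hpow]
    linarith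
  obtain ⟨P, hP, Q, hQ, hPQ⟩ := hμ
  have hne0 : (Finset.univ.filter (fun i : Fin (m + 1) => a i ≠ 0)).Nonempty := by
    have h1 : (newtonPoints p a).Nonempty := convexHull_nonempty_iff.1 ⟨P, hP.1⟩
    obtain ⟨_, i, hi, -⟩ := h1
    exact ⟨i, by simp [hi]⟩
  obtain ⟨i, hi, hmin⟩ := Finset.exists_min_image _
    (fun i : Fin (m + 1) => ((a i).order : ℝ) - μ * (p : ℝ) ^ (i : ℕ)) hne0
  simp only [Finset.mem_filter, Finset.mem_univ, true_and] at hi hmin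
  set P₀ : ℝ × ℝ := ((p : ℝ) ^ (i : ℕ), ((a i).order : ℝ)) with hP₀
  have hP₀mem : P₀ ∈ newtonPolygon p a := subset_convexHull ℝ _ ⟨i, hi, rfl, le_rfl⟩
  have hsub : newtonPolygon p a ⊆
      {R : ℝ × ℝ | P₀.2 - μ * P₀.1 < R.2 - μ * R.1 ∨ R = P₀} := by
    refine convexHull_min ?_ ?_
    · rintro ⟨x, y⟩ ⟨j, hj, hx, hy⟩
      simp only at hx hy
      subst hx
      by_cases hij : i = j
      · subst hij
        rcases hy.lt_or_eq with hy | hy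
        · left; simp only [hP₀]; linarith
        · right; simp [hP₀, hy]
      · left
        have := lt_of_le_of_ne (hmin j hj) (hne i j hij)
        simp only [hP₀]; linarith
    · rintro R hR T hT s t hs ht hst
      have hs' : s = 1 - t := by linarith
      subst hs'
      simp only [Set.mem_ofPred_eq, Prod.fst_add, Prod.snd_add, Prod.smul_fst, Prod.smul_snd,
        smul_eq_mul]
      rcases hs.eq_or_lt with h0 | h0
      · have : t = 1 := by linarith
        subst this
        simpa using hT
      rcases ht.eq_or_lt with h1 | h1
      · subst h1
        simpa using hR
      rcases hR with hR | rfl <;> rcases hT with hT | rfl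
      · left; nlinarith
      · left; nlinarith
      · left; nlinarith
      · right
        rw [← add_smul]
        simp
  have hsingle : ∀ R ∈ edge p a μ, R = P₀ := by
    rintro R ⟨hR, hRmin⟩
    rcases hsub hR with h | h
    · exact absurd (hRmin P₀ hP₀mem) (not_le.2 h)
    · exact h
  exact hPQ ((hsingle P hP).trans (hsingle Q hQ).symm)

/-- The finite set of the slopes of the Newton polygon. -/
def slopes (p : ℕ) (hp : 2 ≤ p) {K : Type*} [Zero K] {m : ℕ}
    (a : Fin (m + 1) → HahnSeries ℚ K) : Finset ℚ :=
  (finite_slopes p hp a).toFinset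

open Classical in
/-- The characteristic polynomial attached to `μ`: the sum of the `cld(a_i) λ^i` over all `i` such
that the point `(p ^ i, val a_i)` belongs to the edge of slope `μ`. -/
def charPoly (p : ℕ) {K : Type*} [Field K] {m : ℕ} (a : Fin (m + 1) → HahnSeries ℚ K) (μ : ℚ) :
    Polynomial K :=
  ∑ i : Fin (m + 1), if a i ≠ 0 ∧ ((p : ℝ) ^ (i : ℕ), ((a i).order : ℝ)) ∈ edge p a μ then
    Polynomial.monomial (i : ℕ) (a i).leadingCoeff else 0

/-- The multiplicity `m_{c,μ}` of `c` as a root of the characteristic polynomial of `μ`. -/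
def mult (p : ℕ) {K : Type*} [Field K] {m : ℕ} (a : Fin (m + 1) → HahnSeries ℚ K)
    (c : Kˣ) (μ : ℚ) : ℕ :=
  (charPoly p a μ).rootMultiplicity (c : K)

/-- The sum `s_{c,μ}` of the multiplicities `m_{c,ν}` over the slopes `ν < μ`. -/
def multBelow (p : ℕ) (hp : 2 ≤ p) {K : Type*} [Field K] {m : ℕ}
    (a : Fin (m + 1) → HahnSeries ℚ K) (c : Kˣ) (μ : ℚ) : ℕ :=
  ∑ ν ∈ (slopes p hp a).filter (fun ν => ν < μ), mult p a c ν

/-- The pairs `(c, μ)` where `μ` is a slope and `c` is an exponent attached to `μ`, that is a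
nonzero root of the characteristic polynomial of `μ`. -/
def IsExponent (p : ℕ) (hp : 2 ≤ p) {K : Type*} [Field K] {m : ℕ}
    (a : Fin (m + 1) → HahnSeries ℚ K) (c : Kˣ) (μ : ℚ) : Prop :=
  μ ∈ slopes p hp a ∧ (charPoly p a μ).IsRoot (c : K)

/-- The triples `(c, μ, i)` where `c` is an exponent attached to the slope `μ` and
`0 ≤ i < m_{c,μ}`. -/
def Idx (p : ℕ) (hp : 2 ≤ p) {K : Type*} [Field K] {m : ℕ}
    (a : Fin (m + 1) → HahnSeries ℚ K) : Type _ :=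
  {t : Kˣ × ℚ × ℕ // IsExponent p hp a t.1 t.2.1 ∧ t.2.2 < mult p a t.1 t.2.1}

end MahlerFrobenius

end

/-! Write `σ` for the automorphism `e_c ↦ c e_c`, `ℓ ↦ ℓ + 1` of the exponential polynomials `⨁ e_c
K[ℓ]`. The ring `𝓡` embeds into the Hahn series over this ring (`solEmb_injective`), so every
nonzero solution has a lowest term `z^v x` with `x` an exponential polynomial. On the supporting
line of slope `-v`, the lowest possible coefficient of `L y` is `χ(σ) x`, with `χ` the
characteristic polynomial of that line; hence `χ(σ) x = 0` (`aeval_charPoly_leading`). On the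
component `e_c K[ℓ]` the operator `σ - c` lowers the degree by exactly one in characteristic zero,
so a nonzero component of `x` has degree less than the multiplicity of `c` in `χ`
(`natDegree_lt_rootMultiplicity`). Thus `-v` is a slope, `c` an exponent, and the degree an
admissible `i`: a nonzero solution has a nonzero coefficient at `z^(-μ) e_c ℓ^i` for some triple
`(c, μ, i)` (`exists_leadCoeff_ne_zero`). The dimension of the solution space is therefore at most
the number of triples. This number is `m`, because the nonzero roots of each `χ_j` number the length
of its edge in the index `i`, and the edges cover `[0, m]` (`card_idx`).

Conversely, `∂_λ` commutes with `L`, and fewer than `s + m_c` derivatives of a multiple of `(λ -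
c)^(s + m_c)` vanish at `λ = c`; so the `y_{c,j,i}` are solutions (`mahlerOp_ev_iterate_dLam`). By
the Leibniz rule the coefficient of `z^(-μ_j)` in `y_{c,j,i}` is `e_c` times a polynomial in `ℓ` of
degree exactly `i`: the `s` vanishing derivatives of `cld h` use up `s` of the `s + i` derivations,
and the next one does not vanish (`jet_coeff_eq_zero`, `jet_coeff_eq`). The family is then
triangular for the coefficients above, hence independent, and its size is the upper bound for the
dimension. -/

noncomputable section

namespace MahlerFrobenius

open Polynomial

/-! ### Exponential polynomials -/

section Shift

variable {K : Type*} [Field K]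

/-- The operator `x(ℓ) ↦ c x(ℓ + 1)` on polynomials. -/
def shift (c : K) : K[X] →ₗ[K] K[X] := c • (taylor 1 : K[X] →ₗ[K] K[X])

theorem shift_apply (c : K) (x : K[X]) : shift c x = c • taylor 1 x := rfl

/-- The substitution `ℓ ↦ ℓ + 1` fixes leading coefficients, so on the graded pieces of the degree
filtration `shift c` is the scalar `c`, and a polynomial `g` in it is the scalar `g(c)`. -/
theorem aeval_shift_top (c : K) (g : K[X]) (d : ℕ) (x : K[X]) (hx : x.natDegree ≤ d) :
    (aeval (shift c) g x).natDegree ≤ d ∧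
      (aeval (shift c) g x).coeff d = g.eval c * x.coeff d := by
  have top : ∀ x : K[X], x.natDegree ≤ d →
      (shift c x).natDegree ≤ d ∧ (shift c x).coeff d = c * x.coeff d := by
    intro x hx
    refine ⟨(natDegree_smul_le _ _).trans ((natDegree_taylor x 1).trans_le hx), ?_⟩
    rw [shift_apply, coeff_smul, smul_eq_mul]
    rcases hx.lt_or_eq with h | rfl
    · rw [coeff_eq_zero_of_natDegree_lt h, coeff_eq_zero_of_natDegree_lt]
      rwa [natDegree_taylor]
    · rw [coeff_taylor_natDegree, leadingCoeff]
  induction g using Polynomial.induction_on' with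
  | add g₁ g₂ h₁ h₂ =>
    rw [map_add, LinearMap.add_apply, eval_add, coeff_add, h₁.2, h₂.2, add_mul]
    exact ⟨natDegree_add_le_of_degree_le h₁.1 h₂.1, rfl⟩
  | monomial n b =>
    have pow : ∀ n : ℕ, ((shift c ^ n) x).natDegree ≤ d ∧
        ((shift c ^ n) x).coeff d = c ^ n * x.coeff d := by
      intro n
      induction n with
      | zero => simpa using hx
      | succ n ih =>
        rw [pow_succ', Module.End.mul_apply]
        refine ⟨(top _ ih.1).1, ?_⟩
        rw [(top _ ih.1).2, ih.2]
        ring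
    rw [aeval_monomial, Module.algebraMap_end_eq_smul_id, smul_mul_assoc, LinearMap.smul_apply,
      Module.End.mul_apply, LinearMap.id_apply, eval_monomial, coeff_smul, (pow n).2, smul_eq_mul,
      mul_assoc]
    exact ⟨(natDegree_smul_le _ _).trans (pow n).1, rfl⟩

/-- `shift c - c` is `c` times the forward difference, which acts on top terms like the derivative.
-/
theorem shift_sub_top (c : K) (d : ℕ) (x : K[X]) (hx : x.natDegree ≤ d + 1) :
    ((shift c - algebraMap K (Module.End K K[X]) c) x).natDegree ≤ d ∧
      ((shift c - algebraMap K (Module.End K K[X]) c) x).coeff d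
        = c * ((d + 1 : ℕ) : K) * x.coeff (d + 1) := by
  have e : (shift c - algebraMap K (Module.End K K[X]) c) x = c • (taylor 1 x - x) := by
    rw [LinearMap.sub_apply, Module.algebraMap_end_apply, shift_apply, smul_sub]
  have hc : ∀ k, (taylor 1 x).coeff k = (hasseDeriv k x).eval 1 := fun k => taylor_coeff 1 x k
  rw [e]
  constructor
  · refine (natDegree_smul_le _ _).trans (natDegree_le_iff_coeff_eq_zero.2 fun N hN => ?_)
    rw [coeff_sub]
    rcases (Nat.succ_le_of_lt hN).eq_or_lt with h | h
    · subst h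
      rcases hx.lt_or_eq with h | h
      · rw [coeff_eq_zero_of_natDegree_lt h, coeff_eq_zero_of_natDegree_lt, sub_zero]
        rwa [natDegree_taylor]
      · rw [Nat.succ_eq_add_one, ← h, coeff_taylor_natDegree, leadingCoeff, sub_self]
    · rw [coeff_eq_zero_of_natDegree_lt (hx.trans_lt h), coeff_eq_zero_of_natDegree_lt, sub_zero]
      rw [natDegree_taylor]
      exact hx.trans_lt h
  · have hd : (hasseDeriv d x).natDegree ≤ 1 := (natDegree_hasseDeriv_le x d).trans (by omega)
    rw [coeff_smul, coeff_sub, hc, eval_eq_sum_range' (Nat.lt_succ_of_le hd),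
      Finset.sum_range_succ, Finset.sum_range_one, hasseDeriv_coeff, hasseDeriv_coeff]
    simp only [zero_add, Nat.choose_self, Nat.add_comm 1 d, Nat.choose_succ_self_right]
    simp
    ring

/-- Factor `χ = (X - c)^n g` with `g(c) ≠ 0`. If `deg x ≥ n`, then `(shift c - c)^n` lowers the
degree by exactly `n`, the factors `d + 1` being nonzero in characteristic zero, and `g(shift c)`
multiplies the remaining top coefficient by `g(c)`; the result cannot vanish. -/
theorem natDegree_lt_rootMultiplicity [CharZero K] {c : K} (hc : c ≠ 0) {χ x : K[X]} (hχ : χ ≠ 0)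
    (hx : x ≠ 0) (h : aeval (shift c) χ x = 0) : x.natDegree < χ.rootMultiplicity c := by
  by_contra! hle
  obtain ⟨g, hg, hgc⟩ := exists_eq_pow_rootMultiplicity_mul_and_not_dvd χ hχ c
  rw [dvd_iff_isRoot, IsRoot.def] at hgc
  have key : ∀ n d : ℕ, ∀ x : K[X], x.natDegree ≤ d + n → x.coeff (d + n) ≠ 0 →
      (((shift c - algebraMap K (Module.End K K[X]) c) ^ n) x).natDegree ≤ d ∧
      (((shift c - algebraMap K (Module.End K K[X]) c) ^ n) x).coeff d ≠ 0 := by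
    intro n
    induction n with
    | zero => exact fun d x h1 h2 => ⟨h1, h2⟩
    | succ n ih =>
      intro d x h1 h2
      rw [pow_succ, Module.End.mul_apply]
      obtain ⟨h3, h4⟩ := shift_sub_top c (d + n) x h1
      refine ih d _ h3 ?_
      rw [h4]
      exact mul_ne_zero (mul_ne_zero hc (Nat.cast_ne_zero.2 (by omega))) h2
  obtain ⟨d, hd⟩ := Nat.exists_eq_add_of_le' hle
  obtain ⟨h1, h2⟩ := key _ d x hd.le (by rw [← hd]; exact leadingCoeff_ne_zero.2 hx)
  rw [hg, mul_comm, map_mul, Module.End.mul_apply, map_pow, map_sub, aeval_X, aeval_C] at h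
  have h3 := (aeval_shift_top c g d _ h1).2
  rw [h, coeff_zero] at h3
  exact mul_ne_zero hgc h2 h3.symm

end Shift

/-- The ring `⨁ e_c K[ℓ]` of exponential polynomials. -/
abbrev ExpPoly (K : Type*) [Field K] : Type _ := MonoidAlgebra K[X] Kˣ

namespace ExpPoly

variable {K : Type*} [Field K]

/-- The coefficient of `e_c`. -/
def comp (c : Kˣ) : ExpPoly K →ₗ[K] K[X] where
  toFun x := x.coeff c
  map_add' x y := by simp
  map_smul' r x := by simp

theorem comp_apply (c : Kˣ) (x : ExpPoly K) : comp c x = x.coeff c := rfl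

theorem comp_single (c d : Kˣ) (f : K[X]) [Decidable (d = c)] :
    comp c (MonoidAlgebra.single d f) = if d = c then f else 0 := by
  rw [comp_apply, MonoidAlgebra.coeff_single, Finsupp.single_apply]

theorem exists_comp_ne_zero {x : ExpPoly K} (hx : x ≠ 0) : ∃ c, comp c x ≠ 0 := by
  by_contra! h
  exact hx (MonoidAlgebra.ext (Finsupp.ext h))

/-- The automorphism `e_c ↦ c e_c`, `ℓ ↦ ℓ + 1`. -/
def sigma (K : Type*) [Field K] : ExpPoly K →ₐ[K] ExpPoly K :=
  { MonoidAlgebra.liftNCRingHom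
      ((MonoidAlgebra.singleOneRingHom (R := K[X]) (M := Kˣ)).comp
        (taylorAlgHom (1 : K) : K[X] →+* K[X]))
      ({ toFun := fun c => MonoidAlgebra.single c (C (c : K))
         map_one' := by simp [MonoidAlgebra.one_def]
         map_mul' := fun c d => by simp [MonoidAlgebra.single_mul_single] } : Kˣ →* ExpPoly K)
      (fun _ _ => Commute.all _ _) with
    commutes' := fun r => by
      simp [MonoidAlgebra.coe_algebraMap, MonoidAlgebra.liftNCRingHom_single,
        MonoidAlgebra.singleOneRingHom, MonoidAlgebra.single_mul_single, taylor_C] }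

theorem sigma_single (c : Kˣ) (f : K[X]) :
    sigma K (MonoidAlgebra.single c f) = MonoidAlgebra.single c (shift (c : K) f) := by
  refine (MonoidAlgebra.liftNCRingHom_single _ _ (fun _ _ => Commute.all _ _) c f).trans ?_
  simp [MonoidAlgebra.singleOneRingHom, MonoidAlgebra.single_mul_single, shift_apply,
    smul_eq_C_mul, mul_comm]

theorem comp_sigma (c : Kˣ) (x : ExpPoly K) : comp c (sigma K x) = shift (c : K) (comp c x) := by
  classical
  induction x using MonoidAlgebra.induction_linear with
  | zero => simp
  | add x y hx hy => rw [map_add, map_add, map_add, map_add, hx, hy]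
  | single d f =>
    rw [sigma_single, comp_single, comp_single]
    split_ifs with h
    · rw [h]
    · simp

theorem comp_aeval_sigma (c : Kˣ) (χ : K[X]) (x : ExpPoly K) :
    comp c (aeval (sigma K).toLinearMap χ x) = aeval (shift (c : K)) χ (comp c x) := by
  induction χ using Polynomial.induction_on' with
  | add f g hf hg => simp only [map_add, LinearMap.add_apply, hf, hg]
  | monomial n b =>
    have : ∀ n : ℕ, comp c (((sigma K).toLinearMap ^ n) x) = (shift (c : K) ^ n) (comp c x) := by
      intro n
      induction n with
      | zero => rfl
      | succ n ih =>
        rw [pow_succ', pow_succ', Module.End.mul_apply, Module.End.mul_apply, ← ih]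
        exact comp_sigma c _
    simp only [aeval_monomial, Module.End.mul_apply, Module.algebraMap_end_apply, map_smul, this]

end ExpPoly

/-! ### Hahn series -/

theorem mahler_coeff (p : ℕ) (hp : 2 ≤ p) {R : Type*} [CommRing R] (x : HahnSeries ℚ R) (γ : ℚ) :
    (mahler p hp R x).coeff γ = x.coeff (γ / p) := by
  have h0 : (p : ℚ) ≠ 0 := Nat.cast_ne_zero.2 (by omega)
  have := HahnSeries.embDomain_coeff
    (f := ⟨⟨AddMonoidHom.mulLeft (p : ℚ), mulLeft_injective p hp⟩, mulLeft_le_iff p hp _ _⟩)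
    (x := x) (a := γ / p)
  rw [← this]
  congr 1
  exact (mul_div_cancel₀ γ h0).symm

theorem hahnMap_coeff {R S : Type*} [CommRing R] [CommRing S] (f : R →+* S) (x : HahnSeries ℚ R)
    (γ : ℚ) : (hahnMap f x).coeff γ = f (x.coeff γ) := rfl

theorem hahnMap_C {R S : Type*} [CommRing R] [CommRing S] (f : R →+* S) (r : R) :
    hahnMap f (HahnSeries.C r) = HahnSeries.C (f r) :=
  HahnSeries.map_C r f

/-- Here `s` and `t` are only lower bounds for the supports, not the orders, so the formula also
covers the terms of `L` that lie off the edge and contribute zero. -/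
theorem coeff_mul_of_lower_bound {R : Type*} [CommRing R] {x y : HahnSeries ℚ R} {s t : ℚ}
    (hx : ∀ γ < s, x.coeff γ = 0) (hy : ∀ γ < t, y.coeff γ = 0) :
    (x * y).coeff (s + t) = x.coeff s * y.coeff t := by
  rw [HahnSeries.coeff_mul]
  refine Finset.sum_eq_single (s, t) ?_ ?_
  · rintro ⟨i, j⟩ hij hne
    have hsum : i + j = s + t := (Finset.mem_antidiagonal.1 hij).2.2
    rcases lt_trichotomy i s with h | h | h
    · rw [hx i h, zero_mul]
    · exact absurd (Prod.ext h (by dsimp only; linarith)) hne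
    · rw [hy j (by linarith), mul_zero]
  · intro h
    by_contra h0
    exact h (Finset.mem_antidiagonal.2
      ⟨left_ne_zero_of_mul h0, right_ne_zero_of_mul h0, rfl⟩)

/-! ### The embedding of `𝓡` into the Hahn series over the exponential polynomials -/

section Embedding

variable {K : Type*} [Field K]

/-- The ring homomorphism that defines `solEmb`. -/
def polyToHahn (K : Type*) [Field K] :
    MvPolynomial (Option Kˣ) (HahnSeries ℚ K) →+* HahnSeries ℚ (ExpPoly K) :=
  MvPolynomial.eval₂Hom (hahnMap (algebraMap K (ExpPoly K))) (fun v =>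
    match v with
    | some c => HahnSeries.C (MonoidAlgebra.single c 1)
    | none => HahnSeries.C (MonoidAlgebra.single 1 X))

/-- The embedding of `𝓡` into the ring of Hahn series over the exponential polynomials. -/
def solEmb (K : Type*) [Field K] : SolRing K →+* HahnSeries ℚ (ExpPoly K) :=
  Ideal.Quotient.lift (relIdeal K) (polyToHahn K) (by
    suffices relIdeal K ≤ RingHom.ker (polyToHahn K) from fun x hx => this hx
    refine Ideal.span_le.2 ?_
    rintro x (hx | ⟨⟨c, d⟩, rfl⟩)
    · rw [Set.mem_singleton_iff] at hx
      subst hx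
      simp [polyToHahn, RingHom.mem_ker, ← MonoidAlgebra.one_def]
    · simp [polyToHahn, RingHom.mem_ker, MonoidAlgebra.single_mul_single])

theorem solEmb_mk (x : MvPolynomial (Option Kˣ) (HahnSeries ℚ K)) :
    solEmb K (toSolRing K x) = polyToHahn K x := rfl

theorem solEmb_hahn (f : HahnSeries ℚ K) :
    solEmb K (hahnToSolRing K f) = hahnMap (algebraMap K (ExpPoly K)) f := by
  simp [hahnToSolRing, solEmb_mk, polyToHahn]

theorem solEmb_eConst (c : Kˣ) :
    solEmb K (eConst c) = HahnSeries.C (MonoidAlgebra.single c 1) := by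
  simp [eConst, solEmb_mk, polyToHahn]

theorem solEmb_ell : solEmb K (ell K) = HahnSeries.C (MonoidAlgebra.single 1 X) := by
  simp [ell, solEmb_mk, polyToHahn]

theorem solEmb_algebraMap (r : K) :
    solEmb K (algebraMap K (SolRing K) r) = HahnSeries.C (algebraMap K (ExpPoly K) r) := by
  change solEmb K (hahnToSolRing K (HahnSeries.C r)) = _
  rw [solEmb_hahn, hahnMap_C]

theorem coeff_solEmb_smul (r : K) (y : SolRing K) (γ : ℚ) :
    (solEmb K (r • y)).coeff γ = r • (solEmb K y).coeff γ := by
  rw [Algebra.smul_def, map_mul, solEmb_algebraMap, HahnSeries.C_mul_eq_smul, HahnSeries.coeff_smul,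
    Algebra.smul_def r, smul_eq_mul]

/-- The elements of `𝓡` as combinations of the `e_c ℓ ^ k`. -/
def ofCoeffs (K : Type*) [Field K] : (Kˣ × ℕ →₀ HahnSeries ℚ K) →+ SolRing K :=
  Finsupp.liftAddHom fun ck =>
    (AddMonoidHom.mulRight (eConst ck.1 * ell K ^ ck.2)).comp
      (hahnToSolRing K : HahnSeries ℚ K →+ SolRing K)

theorem ofCoeffs_single (ck : Kˣ × ℕ) (f : HahnSeries ℚ K) :
    ofCoeffs K (Finsupp.single ck f) = hahnToSolRing K f * (eConst ck.1 * ell K ^ ck.2) := by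
  simp [ofCoeffs]

theorem eConst_mul (c d : Kˣ) : eConst (K := K) c * eConst d = eConst (c * d) := by
  rw [eConst, eConst, eConst, ← map_mul]
  exact Ideal.Quotient.eq.2 (Ideal.subset_span (Or.inr ⟨(c, d), rfl⟩))

theorem eConst_one : eConst (K := K) 1 = 1 := by
  rw [eConst, ← map_one (toSolRing K)]
  exact Ideal.Quotient.eq.2 (Ideal.subset_span (Or.inl rfl))

/-- The relations collapse any product of the `e_c` to a single one, so the `e_c ℓ^k` span `𝓡` over
the Hahn series. -/
theorem ofCoeffs_surjective : Function.Surjective (ofCoeffs K) := by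
  intro y
  obtain ⟨y, rfl⟩ := Ideal.Quotient.mk_surjective y
  change ∃ F, ofCoeffs K F = toSolRing K y
  induction y using MvPolynomial.induction_on with
  | C f =>
    exact ⟨Finsupp.single (1, 0) f, by rw [ofCoeffs_single, eConst_one, pow_zero]; simp; rfl⟩
  | add y z hy hz =>
    obtain ⟨F, hF⟩ := hy
    obtain ⟨G, hG⟩ := hz
    exact ⟨F + G, by rw [map_add, hF, hG, map_add]⟩
  | mul_X y v hy =>
    obtain ⟨F, hF⟩ := hy
    rw [map_mul, ← hF]
    clear hF
    induction F using Finsupp.induction_linear with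
    | zero => exact ⟨0, by simp⟩
    | add F G hF hG =>
      obtain ⟨F', hF⟩ := hF
      obtain ⟨G', hG⟩ := hG
      exact ⟨F' + G', by rw [map_add, hF, hG, map_add, add_mul]⟩
    | single ck f =>
      match v with
      | some d =>
        refine ⟨Finsupp.single (ck.1 * d, ck.2) f, ?_⟩
        rw [ofCoeffs_single, ofCoeffs_single, ← eConst_mul]
        change _ = _ * eConst d
        ring
      | none =>
        refine ⟨Finsupp.single (ck.1, ck.2 + 1) f, ?_⟩
        rw [ofCoeffs_single, ofCoeffs_single, pow_succ]
        change _ = _ * ell K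
        ring

/-- All coefficients of a combination of the `e_c ℓ^k` can be read off from its image. Together with
`ofCoeffs_surjective` this gives the injectivity of `solEmb`, with no prior knowledge that the `e_c
ℓ^k` are independent in the quotient. -/
theorem coeff_solEmb_ofCoeffs (F : Kˣ × ℕ →₀ HahnSeries ℚ K) (γ : ℚ) (c : Kˣ) (k : ℕ) :
    (ExpPoly.comp c ((solEmb K (ofCoeffs K F)).coeff γ)).coeff k = (F (c, k)).coeff γ := by
  classical
  induction F using Finsupp.induction_linear with
  | zero => simp
  | add F G hF hG => simp [hF, hG]
  | single dj f =>
    obtain ⟨d, j⟩ := dj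
    have e : solEmb K (ofCoeffs K (Finsupp.single (d, j) f)) =
        hahnMap (algebraMap K (ExpPoly K)) f * HahnSeries.C (MonoidAlgebra.single d (X ^ j)) := by
      rw [ofCoeffs_single, map_mul, map_mul, map_pow, solEmb_hahn, solEmb_eConst, solEmb_ell,
        ← map_pow, ← map_mul, MonoidAlgebra.single_pow, MonoidAlgebra.single_mul_single]
      simp
    rw [e, mul_comm, HahnSeries.C_mul_eq_smul, HahnSeries.coeff_smul, hahnMap_coeff, smul_eq_mul,
      mul_comm, ← Algebra.smul_def, map_smul, ExpPoly.comp_single, Finsupp.single_apply]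
    simp only [Prod.mk.injEq]
    by_cases h1 : d = c <;> simp [h1, coeff_X_pow, eq_comm, apply_ite (HahnSeries.coeff · γ)]

theorem solEmb_injective : Function.Injective (solEmb K) := by
  rw [injective_iff_map_eq_zero]
  intro y hy
  obtain ⟨F, rfl⟩ := ofCoeffs_surjective y
  suffices F = 0 by rw [this, map_zero]
  ext ⟨c, k⟩ γ
  rw [← coeff_solEmb_ofCoeffs, hy]
  simp

/-- The operator `φ_p` on the Hahn series over the exponential polynomials. -/
def hahnPhi (p : ℕ) (hp : 2 ≤ p) (K : Type*) [Field K] :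
    HahnSeries ℚ (ExpPoly K) →+* HahnSeries ℚ (ExpPoly K) :=
  (mahler p hp (ExpPoly K)).comp (hahnMap (ExpPoly.sigma K : ExpPoly K →+* ExpPoly K))

theorem hahnPhi_coeff (p : ℕ) (hp : 2 ≤ p) (i : ℕ) (w : HahnSeries ℚ (ExpPoly K)) (γ : ℚ) :
    ((hahnPhi p hp K)^[i] w).coeff γ =
      ((ExpPoly.sigma K).toLinearMap ^ i) (w.coeff (γ / (p : ℚ) ^ i)) := by
  induction i generalizing γ with
  | zero => simp
  | succ i ih =>
    rw [Function.iterate_succ_apply', pow_succ', Module.End.mul_apply, pow_succ', ← div_div,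
      ← ih, hahnPhi, RingHom.comp_apply, mahler_coeff, hahnMap_coeff]
    rfl

theorem solEmb_phi (p : ℕ) (hp : 2 ≤ p) (y : SolRing K) :
    solEmb K (phi p hp K y) = hahnPhi p hp K (solEmb K y) := by
  obtain ⟨y, rfl⟩ := Ideal.Quotient.mk_surjective y
  change polyToHahn K (phiPoly p hp K y) = hahnPhi p hp K (polyToHahn K y)
  have mC : ∀ x : ExpPoly K, mahler p hp (ExpPoly K) (HahnSeries.C x) = HahnSeries.C x :=
    fun x => HahnSeries.embDomainRingHom_C
  rw [← RingHom.comp_apply, ← RingHom.comp_apply]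
  congr 1
  refine MvPolynomial.ringHom_ext (fun f => ?_) (fun v => ?_)
  · simp only [RingHom.comp_apply, phiPoly, polyToHahn, MvPolynomial.eval₂Hom_C, hahnPhi]
    refine HahnSeries.ext (funext fun γ => ?_)
    rw [hahnMap_coeff, mahler_coeff, mahler_coeff, hahnMap_coeff, hahnMap_coeff]
    exact ((ExpPoly.sigma K).commutes _).symm
  · match v with
    | some c =>
      simp only [RingHom.comp_apply, phiPoly, polyToHahn, MvPolynomial.eval₂Hom_X', map_mul,
        MvPolynomial.eval₂Hom_C, hahnPhi, hahnMap_C, mC, RingHom.coe_coe, ExpPoly.sigma_single]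
      rw [← map_mul, ← Algebra.smul_def, MonoidAlgebra.smul_single, shift_apply, taylor_one,
        C_1]
    | none =>
      simp only [RingHom.comp_apply, phiPoly, polyToHahn, MvPolynomial.eval₂Hom_X', map_add,
        map_one, hahnPhi, hahnMap_C, mC, RingHom.coe_coe, ExpPoly.sigma_single]
      rw [← map_one HahnSeries.C, ← map_add, MonoidAlgebra.one_def, ← MonoidAlgebra.single_add,
        shift_apply, taylor_X, Units.val_one, one_smul, C_1]

theorem solEmb_mahlerOp (p : ℕ) (hp : 2 ≤ p) {m : ℕ} (a : Fin (m + 1) → HahnSeries ℚ K)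
    (y : SolRing K) :
    solEmb K (mahlerOp (hahnToSolRing K) (phi p hp K) a y) =
      mahlerOp (hahnMap (algebraMap K (ExpPoly K))) (hahnPhi p hp K) a (solEmb K y) := by
  have : ∀ i, solEmb K ((phi p hp K)^[i] y) = (hahnPhi p hp K)^[i] (solEmb K y) := by
    intro i
    induction i with
    | zero => rfl
    | succ i ih => rw [Function.iterate_succ_apply', Function.iterate_succ_apply', solEmb_phi, ih]
  simp only [mahlerOp, map_sum, map_mul, solEmb_hahn, this]

end Embedding

/-! ### The edges of the Newton polygon -/

section Newton

variable {K : Type*} [Field K] {m : ℕ}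

/-- The index `i` contributes a point to the edge of slope `μ`. -/
def OnEdge (p : ℕ) (a : Fin (m + 1) → HahnSeries ℚ K) (μ : ℚ) (i : Fin (m + 1)) : Prop :=
  a i ≠ 0 ∧ ∀ j, a j ≠ 0 →
    (a i).order - μ * (p : ℚ) ^ (i : ℕ) ≤ (a j).order - μ * (p : ℚ) ^ (j : ℕ)

variable {p : ℕ} {a : Fin (m + 1) → HahnSeries ℚ K} {μ ν : ℚ} {i j : Fin (m + 1)}

/-- A linear form bounded below on the generating points is bounded below on their convex hull; the
geometry of the polygon thus reduces to finitely many inequalities in `ℚ`. -/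
theorem onEdge_iff :
    OnEdge p a μ i ↔ a i ≠ 0 ∧ ((p : ℝ) ^ (i : ℕ), ((a i).order : ℝ)) ∈ edge p a μ := by
  refine and_congr_right fun hi => ⟨fun h => ⟨subset_convexHull ℝ _ ⟨i, hi, rfl, le_rfl⟩, ?_⟩,
    fun h j hj => ?_⟩
  · have hsub : newtonPolygon p a ⊆ {Q : ℝ × ℝ |
        ((a i).order : ℝ) - (μ : ℝ) * (p : ℝ) ^ (i : ℕ) ≤ Q.2 - (μ : ℝ) * Q.1} := by
      refine convexHull_min ?_ ?_
      · rintro ⟨x, y⟩ ⟨j, hj, hx, hy⟩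
        simp only at hx hy
        subst hx
        have : ((a i).order : ℝ) - (μ : ℝ) * (p : ℝ) ^ (i : ℕ)
            ≤ ((a j).order : ℝ) - (μ : ℝ) * (p : ℝ) ^ (j : ℕ) := by exact_mod_cast h j hj
        simp only [Set.mem_ofPred_eq]
        linarith
      · rintro R hR T hT s t hs ht hst
        have hs' : s = 1 - t := by linarith
        subst hs'
        simp only [Set.mem_ofPred_eq, Prod.fst_add, Prod.snd_add, Prod.smul_fst, Prod.smul_snd,
          smul_eq_mul] at hR hT ⊢
        nlinarith
    exact fun Q hQ => hsub hQ
  · have := h.2 ((p : ℝ) ^ (j : ℕ), ((a j).order : ℝ))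
      (subset_convexHull ℝ _ ⟨j, hj, rfl, le_rfl⟩)
    dsimp only at this
    exact_mod_cast this

theorem mem_slopes_of_onEdge (hp : 2 ≤ p) (hi : OnEdge p a μ i) (hj : OnEdge p a μ j)
    (hij : i ≠ j) : μ ∈ slopes p hp a := by
  refine (Set.Finite.mem_toFinset _).2
    ⟨_, (onEdge_iff.1 hi).2, _, (onEdge_iff.1 hj).2, fun h => hij (Fin.ext ?_)⟩
  have h1 : (p : ℝ) ^ (i : ℕ) = (p : ℝ) ^ (j : ℕ) := (Prod.ext_iff.1 h).1
  have : p ^ (i : ℕ) = p ^ (j : ℕ) := by exact_mod_cast h1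
  exact Nat.pow_right_injective hp this

theorem exists_onEdge (p : ℕ) (μ : ℚ) (h0 : a 0 ≠ 0) : ∃ i, OnEdge p a μ i := by
  classical
  obtain ⟨i, hi, hmin⟩ := Finset.exists_min_image (Finset.univ.filter (fun i => a i ≠ 0))
    (fun i : Fin (m + 1) => (a i).order - μ * (p : ℚ) ^ (i : ℕ)) ⟨0, by simp [h0]⟩
  exact ⟨i, by simpa using hi, fun j hj => hmin j (by simp [hj])⟩

/-- Convexity: adding the two minimality conditions gives `(ν - μ)(p^i - p^j) ≤ 0`. -/
theorem OnEdge.le_of_lt (hp : 2 ≤ p) (hi : OnEdge p a μ i) (hj : OnEdge p a ν j) (h : μ < ν) :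
    i ≤ j := by
  have h1 := hi.2 j hj.1
  have h2 := hj.2 i hi.1
  by_contra! hlt
  have h3 : (p : ℚ) ^ (j : ℕ) < (p : ℚ) ^ (i : ℕ) := by exact_mod_cast Nat.pow_lt_pow_right hp hlt
  nlinarith

theorem OnEdge.coeff_eq_zero (hi : OnEdge p a μ i) (j : Fin (m + 1)) {γ : ℚ}
    (hγ : γ < (a i).order - μ * (p : ℚ) ^ (i : ℕ) + μ * (p : ℚ) ^ (j : ℕ)) :
    (a j).coeff γ = 0 := by
  by_cases hj : a j = 0
  · rw [hj, HahnSeries.coeff_zero]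
  · exact HahnSeries.coeff_eq_zero_of_lt_order (by linarith [hi.2 j hj])

/-- Reading each `a_j` at the height of the supporting line removes the case distinction: off the
edge this height is below the order of `a_j`. -/
theorem OnEdge.charPoly_eq (hi : OnEdge p a μ i) :
    charPoly p a μ = ∑ j : Fin (m + 1), monomial (j : ℕ)
      ((a j).coeff ((a i).order - μ * (p : ℚ) ^ (i : ℕ) + μ * (p : ℚ) ^ (j : ℕ))) := by
  refine Finset.sum_congr rfl fun j _ => ?_
  by_cases hj : OnEdge p a μ j
  · rw [if_pos (onEdge_iff.1 hj), HahnSeries.leadingCoeff_eq]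
    congr 2
    linarith [hj.2 i hi.1, hi.2 j hj.1]
  · rw [if_neg fun h => hj (onEdge_iff.2 h)]
    symm
    rw [monomial_eq_zero_iff]
    by_cases h0 : a j = 0
    · rw [h0, HahnSeries.coeff_zero]
    · refine HahnSeries.coeff_eq_zero_of_lt_order ?_
      have := hi.2 j h0
      by_contra! hle
      exact hj ⟨h0, fun k hk => by linarith [hi.2 k hk]⟩

theorem charPoly_coeff_ne_zero_iff {n : ℕ} :
    (charPoly p a μ).coeff n ≠ 0 ↔ ∃ i : Fin (m + 1), (i : ℕ) = n ∧ OnEdge p a μ i := by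
  simp only [charPoly, finsetSum_coeff]
  constructor
  · intro h
    obtain ⟨i, -, hi⟩ := Finset.exists_ne_zero_of_sum_ne_zero h
    split_ifs at hi with h1
    · rw [coeff_monomial] at hi
      exact ⟨i, of_not_not fun h2 => hi (if_neg h2), onEdge_iff.2 h1⟩
    · exact absurd (coeff_zero n) hi
  · rintro ⟨i, rfl, hi⟩
    rw [Finset.sum_eq_single i, if_pos (onEdge_iff.1 hi), coeff_monomial, if_pos rfl]
    · exact HahnSeries.leadingCoeff_ne_zero.2 hi.1
    · intro j _ hj
      split_ifs
      · rw [coeff_monomial, if_neg fun h => hj (Fin.ext h)]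
      · exact coeff_zero _
    · exact fun h => absurd (Finset.mem_univ i) h

/-- This holds for every rational `μ`, slope or not, since each supporting line touches some point;
for a non-slope the polynomial is a monomial. -/
theorem charPoly_ne_zero (p : ℕ) (μ : ℚ) (h0 : a 0 ≠ 0) : charPoly p a μ ≠ 0 := by
  obtain ⟨i, hi⟩ := exists_onEdge p μ h0
  intro h
  exact charPoly_coeff_ne_zero_iff.2 ⟨i, rfl, hi⟩ (by rw [h, coeff_zero])

theorem exists_onEdge_natDegree (p : ℕ) (μ : ℚ) (h0 : a 0 ≠ 0) :
    ∃ i : Fin (m + 1), (i : ℕ) = (charPoly p a μ).natDegree ∧ OnEdge p a μ i :=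
  charPoly_coeff_ne_zero_iff.1 (leadingCoeff_ne_zero.2 (charPoly_ne_zero p μ h0))

theorem exists_onEdge_natTrailingDegree (p : ℕ) (μ : ℚ) (h0 : a 0 ≠ 0) :
    ∃ i : Fin (m + 1), (i : ℕ) = (charPoly p a μ).natTrailingDegree ∧ OnEdge p a μ i :=
  charPoly_coeff_ne_zero_iff.1 (trailingCoeff_nonzero_iff_nonzero.2 (charPoly_ne_zero p μ h0))

/-- A characteristic polynomial with a nonzero root belongs to a slope. -/
theorem mem_slopes_of_isRoot (hp : 2 ≤ p) (h0 : a 0 ≠ 0) {c : K} (hc : c ≠ 0)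
    (h : (charPoly p a μ).IsRoot c) : μ ∈ slopes p hp a := by
  obtain ⟨i, hi⟩ := exists_onEdge p μ h0
  by_contra hμ
  have hall : ∀ j, OnEdge p a μ j → j = i := fun j hj =>
    of_not_not fun hne => hμ (mem_slopes_of_onEdge hp hj hi hne)
  have hmono : charPoly p a μ = monomial (i : ℕ) ((charPoly p a μ).coeff i) := by
    ext n
    rw [coeff_monomial]
    split_ifs with hn
    · rw [hn]
    · by_contra hne
      obtain ⟨j, hj, hj'⟩ := charPoly_coeff_ne_zero_iff.1 hne
      exact hn (by rw [← hj, hall j hj'])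
  rw [IsRoot.def, hmono, eval_monomial] at h
  exact mul_ne_zero (charPoly_coeff_ne_zero_iff.2 ⟨i, rfl, hi⟩) (pow_ne_zero _ hc) h

/-- Some edge of the Newton polygon passes over the interval from `p ^ t` to `p ^ (t + 1)`. -/
theorem exists_edge_over (hp : 2 ≤ p) (h0 : a 0 ≠ 0) (hlast : a (Fin.last m) ≠ 0) {t : ℕ}
    (ht : t < m) : ∃ (μ : ℚ) (i j : Fin (m + 1)), (i : ℕ) ≤ t ∧ t < (j : ℕ) ∧
      OnEdge p a μ i ∧ OnEdge p a μ j := by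
  classical
  set A := Finset.univ.filter (fun i : Fin (m + 1) => a i ≠ 0 ∧ (i : ℕ) ≤ t) with hA
  set B := Finset.univ.filter (fun i : Fin (m + 1) => a i ≠ 0 ∧ t < (i : ℕ)) with hB
  -- The edge is found by a min-max. For each `j` to the right of the gap, the steepest segment
  -- arriving from the left spans a line below all left points; the right endpoint whose steepest
  -- segment has the least slope then gives a line below the right points too.
  let sl : Fin (m + 1) → Fin (m + 1) → ℚ := fun j i =>
    ((a j).order - (a i).order) / ((p : ℚ) ^ (j : ℕ) - (p : ℚ) ^ (i : ℕ))
  have hAne : A.Nonempty := ⟨0, by simp [hA, h0]⟩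
  have hBne : B.Nonempty := ⟨Fin.last m, by simp [hB, hlast, ht]⟩
  have hmax : ∀ j, ∃ i ∈ A, ∀ i' ∈ A, sl j i' ≤ sl j i := fun j =>
    Finset.exists_max_image A (sl j) hAne
  choose f hfA hf using hmax
  obtain ⟨j, hjB, hj⟩ := Finset.exists_min_image B (fun j => sl j (f j)) hBne
  have hpos : ∀ i ∈ A, ∀ j ∈ B, (0 : ℚ) < (p : ℚ) ^ (j : ℕ) - (p : ℚ) ^ (i : ℕ) := by
    intro i hi j hj
    simp only [hA, hB, Finset.mem_filter, Finset.mem_univ, true_and] at hi hj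
    have : (p : ℚ) ^ (i : ℕ) < (p : ℚ) ^ (j : ℕ) := by
      exact_mod_cast Nat.pow_lt_pow_right hp (hi.2.trans_lt hj.2)
    linarith
  set μ := sl j (f j) with hμ
  have h1 : ∀ i ∈ A, (a j).order - μ * (p : ℚ) ^ (j : ℕ) ≤ (a i).order - μ * (p : ℚ) ^ (i : ℕ) := by
    intro i hi
    have h := hf j i hi
    rw [div_le_iff₀ (hpos i hi j hjB)] at h
    linarith
  have h2 : (a j).order - μ * (p : ℚ) ^ (j : ℕ)
      = (a (f j)).order - μ * (p : ℚ) ^ (f j : ℕ) := by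
    have h := div_mul_cancel₀ ((a j).order - (a (f j)).order) (hpos _ (hfA j) j hjB).ne'
    change μ * _ = _ at h
    linarith
  have h3 : ∀ k ∈ B, (a j).order - μ * (p : ℚ) ^ (j : ℕ)
      ≤ (a k).order - μ * (p : ℚ) ^ (k : ℕ) := by
    intro k hk
    -- The comparison with `k` passes through `f k`: this left point is above the line, and the
    -- slope from it to `k` is at least `μ`.
    refine (h1 _ (hfA k)).trans ?_
    have h := hj k hk
    change μ ≤ _ / _ at h
    rw [le_div_iff₀ (hpos _ (hfA k) k hk)] at h
    linarith
  have h4 : ∀ k, a k ≠ 0 → (a j).order - μ * (p : ℚ) ^ (j : ℕ)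
      ≤ (a k).order - μ * (p : ℚ) ^ (k : ℕ) := by
    intro k hk
    rcases le_or_gt (k : ℕ) t with h | h
    · exact h1 k (by simp [hA, hk, h])
    · exact h3 k (by simp [hB, hk, h])
  have hfj := hfA j
  simp only [hA, hB, Finset.mem_filter, Finset.mem_univ, true_and] at hfj hjB
  exact ⟨μ, f j, j, hfj.2, hjB.2, ⟨hfj.1, fun k hk => h2 ▸ h4 k hk⟩, hjB.1, h4⟩

/-- The lengths of the edges add up to `m`. -/
theorem sum_natDegree_sub_natTrailingDegree (hp : 2 ≤ p) (h0 : a 0 ≠ 0)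
    (hlast : a (Fin.last m) ≠ 0) :
    ∑ μ ∈ slopes p hp a,
      ((charPoly p a μ).natDegree - (charPoly p a μ).natTrailingDegree) = m := by
  have hsep : ∀ μ ν, μ < ν → (charPoly p a μ).natDegree ≤ (charPoly p a ν).natTrailingDegree := by
    intro μ ν h
    obtain ⟨i, hi, hi'⟩ := exists_onEdge_natDegree p μ h0
    obtain ⟨j, hj, hj'⟩ := exists_onEdge_natTrailingDegree p ν h0
    rw [← hi, ← hj]
    exact hi'.le_of_lt hp hj' h
  -- The half-open intervals from trailing degree to degree tile `{0, …, m - 1}`.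
  have hdisj : (slopes p hp a : Set ℚ).PairwiseDisjoint (fun μ =>
      Finset.Ico (charPoly p a μ).natTrailingDegree (charPoly p a μ).natDegree) := by
    intro μ _ ν _ hne
    rw [Function.onFun, Finset.disjoint_left]
    intro t h1 h2
    rw [Finset.mem_Ico] at h1 h2
    rcases hne.lt_or_gt with h | h
    · have := hsep _ _ h
      omega
    · have := hsep _ _ h
      omega
  have hunion : (slopes p hp a).biUnion (fun μ =>
      Finset.Ico (charPoly p a μ).natTrailingDegree (charPoly p a μ).natDegree)
      = Finset.range m := by
    ext t
    rw [Finset.mem_biUnion, Finset.mem_range]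
    constructor
    · rintro ⟨μ, -, h⟩
      obtain ⟨i, hi, -⟩ := exists_onEdge_natDegree p μ h0
      have h1 := i.2
      have h2 := (Finset.mem_Ico.1 h).2
      omega
    · intro ht
      obtain ⟨μ, i, j, hi, hj, hi', hj'⟩ := exists_edge_over hp h0 hlast ht
      refine ⟨μ, mem_slopes_of_onEdge hp hi' hj' (by rintro rfl; omega), Finset.mem_Ico.2 ⟨?_, ?_⟩⟩
      · exact (natTrailingDegree_le_of_ne_zero (charPoly_coeff_ne_zero_iff.2 ⟨i, rfl, hi'⟩)).trans hi
      · exact hj.trans_le (le_natDegree_of_ne_zero (charPoly_coeff_ne_zero_iff.2 ⟨j, rfl, hj'⟩))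
  have := Finset.card_biUnion hdisj
  rw [hunion, Finset.card_range] at this
  simpa using this.symm

/-- Over an algebraically closed field all multiplicities add up to the degree, and the root `0`
accounts for the trailing degree. -/
theorem sum_rootMultiplicity [IsAlgClosed K] [DecidableEq K] (χ : K[X]) :
    ∑ c ∈ χ.roots.toFinset.erase 0, χ.rootMultiplicity c = χ.natDegree - χ.natTrailingDegree := by
  have h1 : ∑ c ∈ χ.roots.toFinset, χ.rootMultiplicity c = χ.natDegree := by
    rw [← (IsAlgClosed.splits χ).natDegree_eq_card_roots.symm, ← Multiset.toFinset_sum_count_eq]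
    exact Finset.sum_congr rfl fun c _ => (count_roots χ).symm
  have h2 : χ.rootMultiplicity 0 = χ.natTrailingDegree := rootMultiplicity_eq_natTrailingDegree'
  by_cases h : (0 : K) ∈ χ.roots.toFinset
  · have := Finset.sum_erase_add _ (fun c => χ.rootMultiplicity c) h
    omega
  · have : χ.rootMultiplicity 0 = 0 := by
      rw [← count_roots, Multiset.count_eq_zero]
      simpa using h
    rw [Finset.erase_eq_of_notMem h]
    omega

theorem card_idx [IsAlgClosed K] (hp : 2 ≤ p) (h0 : a 0 ≠ 0) (hlast : a (Fin.last m) ≠ 0) :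
    Nat.card (Idx p hp a) = m := by
  classical
  let F : Finset (Σ _ : ℚ, Σ _ : K, ℕ) := (slopes p hp a).sigma fun μ =>
    ((charPoly p a μ).roots.toFinset.erase 0).sigma fun c =>
      Finset.range ((charPoly p a μ).rootMultiplicity c)
  have hF : F.card = m := by
    rw [← sum_natDegree_sub_natTrailingDegree hp h0 hlast, Finset.card_sigma]
    refine Finset.sum_congr rfl fun μ _ => ?_
    rw [Finset.card_sigma, ← sum_rootMultiplicity]
    simp
  let e : Idx p hp a → F := fun t => ⟨⟨t.1.2.1, (t.1.1 : K), t.1.2.2⟩, by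
    have h1 := t.2.1.1
    have h2 := t.2.1.2
    have h3 := t.2.2
    simp only [F, Finset.mem_sigma, Finset.mem_erase, Multiset.mem_toFinset, Finset.mem_range,
      mem_roots (charPoly_ne_zero p _ h0)]
    exact ⟨h1, ⟨t.1.1.ne_zero, h2⟩, h3⟩⟩
  have he : Function.Bijective e := by
    constructor
    · rintro ⟨⟨c, μ, i⟩, h⟩ ⟨⟨d, ν, j⟩, h'⟩ heq
      simp only [e, Subtype.mk.injEq, Sigma.mk.injEq, heq_eq_eq] at heq
      obtain ⟨rfl, h2, rfl⟩ := heq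
      obtain rfl := Units.ext h2
      rfl
    · rintro ⟨⟨μ, c, i⟩, h⟩
      simp only [F, Finset.mem_sigma, Finset.mem_erase, Multiset.mem_toFinset, Finset.mem_range,
        mem_roots (charPoly_ne_zero p _ h0)] at h
      exact ⟨⟨(Units.mk0 c h.2.1.1, μ, i), ⟨h.1, h.2.1.2⟩, h.2.2⟩, rfl⟩
  rw [Nat.card_congr (Equiv.ofBijective e he), Nat.card_eq_fintype_card, Fintype.card_coe, hF]

end Newton

/-! ### Taylor expansion of the rational functions without pole at `c` -/

section Regular

variable {K : Type*} [Field K]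

/-- The uniformizer `λ - c`. -/
def unif (c : K) : regularAt c := lam c - algebraMap K (regularAt c) c

theorem evalAt_lam (c : K) : evalAt c (lam c) = c := RatFunc.eval_X ..

theorem evalAt_algebraMap (c r : K) : evalAt c (algebraMap K (regularAt c) r) = r := by
  change RatFunc.eval (RingHom.id K) c (algebraMap K (RatFunc K) r) = r
  rw [RatFunc.algebraMap_eq_C, RatFunc.eval_C, RingHom.id_apply]

theorem evalAt_unif (c : K) : evalAt c (unif c) = 0 := by
  rw [unif, map_sub, evalAt_lam, evalAt_algebraMap, sub_self]

theorem derivAt_lam (c : K) : derivAt c (lam c) = 1 := by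
  refine Subtype.ext ?_
  change ratDeriv RatFunc.X = 1
  rw [← RatFunc.algebraMap_X, ratDeriv_algebraMap, derivative_X, map_one]

theorem derivAt_unif (c : K) : derivAt c (unif c) = 1 := by
  rw [unif, map_sub, derivAt_lam, Derivation.map_algebraMap, sub_zero]

/-- The factor `X - c` is taken out of the numerator; the denominator, nonzero at `c`, is kept. -/
theorem unif_dvd {c : K} {g : regularAt c} (h : evalAt c g = 0) : unif c ∣ g := by
  change (g : RatFunc K).num.eval₂ (RingHom.id K) c / (g : RatFunc K).denom.eval₂ (RingHom.id K) c
    = 0 at h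
  have h1 : (g : RatFunc K).num.IsRoot c := (div_eq_zero_iff.1 h).resolve_right (denom_ne g)
  obtain ⟨r, hr⟩ := dvd_iff_isRoot.2 h1
  refine ⟨⟨algebraMap K[X] (RatFunc K) r / algebraMap K[X] (RatFunc K) (g : RatFunc K).denom,
    (regular_iff c _).2 ⟨_, _, g.2, rfl⟩⟩, Subtype.ext ?_⟩
  change (g : RatFunc K) = (RatFunc.X - algebraMap K (RatFunc K) c) * (_ / _)
  rw [← mul_div_assoc, RatFunc.algebraMap_eq_C, ← RatFunc.algebraMap_X, ← RatFunc.algebraMap_C,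
    ← map_sub, ← map_mul, ← hr, RatFunc.num_div_denom]

theorem derivAt_unif_pow_mul (c : K) (n : ℕ) (u : regularAt c) :
    derivAt c (unif c ^ (n + 1) * u)
      = unif c ^ n * ((n + 1 : ℕ) * u + unif c * derivAt c u) := by
  rw [Derivation.leibniz, Derivation.leibniz_pow, derivAt_unif]
  simp only [smul_eq_mul, nsmul_eq_mul, Nat.add_sub_cancel]
  ring

theorem evalAt_iterate_derivAt_of_lt (c : K) {n j : ℕ} (u : regularAt c) (h : j < n) :
    evalAt c ((derivAt c)^[j] (unif c ^ n * u)) = 0 := by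
  obtain ⟨n, rfl⟩ : ∃ k, n = k + 1 := ⟨n - 1, by omega⟩
  induction j generalizing n u with
  | zero => simp [evalAt_unif]
  | succ j ih =>
    obtain ⟨n, rfl⟩ : ∃ k, n = k + 1 := ⟨n - 1, by omega⟩
    rw [Function.iterate_succ_apply, derivAt_unif_pow_mul]
    exact ih _ _ (by omega)

theorem evalAt_iterate_derivAt_self (c : K) (n : ℕ) (u : regularAt c) :
    evalAt c ((derivAt c)^[n] (unif c ^ n * u)) = (n.factorial : K) * evalAt c u := by
  induction n generalizing u with
  | zero => simp
  | succ n ih =>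
    rw [Function.iterate_succ_apply, derivAt_unif_pow_mul, ih, map_add, map_mul, map_mul,
      evalAt_unif, map_natCast, Nat.factorial_succ]
    push_cast
    ring

/-- Turns the `(λ - c)`-adic valuation into conditions on derivatives at `c`; characteristic zero is
needed for `n! ≠ 0`. -/
theorem evalAt_iterate_derivAt_of_emultiplicity [CharZero K] {c : K} {n : ℕ} {g : regularAt c}
    (h : emultiplicity (unif c) g = n) :
    (∀ j < n, evalAt c ((derivAt c)^[j] g) = 0) ∧ evalAt c ((derivAt c)^[n] g) ≠ 0 := by
  obtain ⟨⟨u, rfl⟩, h2⟩ := emultiplicity_eq_coe.1 h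
  refine ⟨fun j hj => evalAt_iterate_derivAt_of_lt c u hj, ?_⟩
  rw [evalAt_iterate_derivAt_self]
  refine mul_ne_zero (Nat.cast_ne_zero.2 n.factorial_ne_zero) fun hu => h2 ?_
  rw [pow_succ]
  exact mul_dvd_mul_left _ (unif_dvd hu)

/-- The polynomial `q(ℓ)` such that `q(ℓ) e_c` is the value at `λ = c` of
`∂_λ^n (g ∂_λ^k e_λ)`. -/
def jet (c : K) : ℕ → ℕ → regularAt c → K[X]
  | 0, k, g => C (evalAt c g * (c ^ k)⁻¹) * ∏ i ∈ Finset.range k, (X - C (i : K))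
  | n + 1, k, g => jet c n k (derivAt c g) + jet c n (k + 1) g

/-- By Leibniz, `∂^n (g ∂^k e_λ)` is a sum of terms `g^(j) ∂^(n-j+k) e_λ`, whose value has degree at
most `n - j + k` in `ℓ`; the terms with `j < s` vanish at `c`, leaving degree at most `n + k - s`.
-/
theorem jet_coeff_eq_zero (c : K) {n k s d : ℕ} {g : regularAt c}
    (hg : ∀ j < s, evalAt c ((derivAt c)^[j] g) = 0) (h : n + k < d + s) :
    (jet c n k g).coeff d = 0 := by
  induction n generalizing k s g with
  | zero =>
    rw [jet]
    rcases Nat.eq_zero_or_pos s with rfl | hs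
    · rw [coeff_C_mul, coeff_eq_zero_of_natDegree_lt, mul_zero]
      rw [natDegree_finsetProd_X_sub_C_eq_card, Finset.card_range]
      omega
    · have := hg 0 hs
      simp only [Function.iterate_zero, id_eq] at this
      simp [this]
  | succ n ih =>
    -- Passing from `g` to its derivative loses one vanishing condition. At `s = 0` the truncated
    -- subtraction is harmless, since `n` has also dropped by one.
    rw [jet, coeff_add, ih hg (by omega), ih (s := s - 1) _ (by omega), add_zero]
    intro j hj
    rw [← Function.iterate_succ_apply]
    exact hg _ (by omega)

/-- Only the Leibniz term `j = s` reaches the extreme degree; the binomial coefficient is built up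
by Pascal's rule. -/
theorem jet_coeff_eq (c : K) {n k s d : ℕ} {g : regularAt c}
    (hg : ∀ j < s, evalAt c ((derivAt c)^[j] g) = 0) (h : n + k = d + s) :
    (jet c n k g).coeff d = (n.choose s : K) * evalAt c ((derivAt c)^[s] g) * (c ^ d)⁻¹ := by
  induction n generalizing k s g with
  | zero =>
    rw [jet]
    rcases Nat.eq_zero_or_pos s with rfl | hs
    · obtain rfl : k = d := by omega
      have h1 : (∏ i ∈ Finset.range k, (X - C (i : K))).coeff k = 1 := by
        have := (monic_prod_X_sub_C (fun i : ℕ => (i : K)) (Finset.range k)).coeff_natDegree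
        rwa [natDegree_finsetProd_X_sub_C_eq_card, Finset.card_range] at this
      rw [coeff_C_mul, h1]
      simp
    · have := hg 0 hs
      simp only [Function.iterate_zero, id_eq] at this
      simp [this, Nat.choose_eq_zero_of_lt hs]
  | succ n ih =>
    rw [jet, coeff_add, ih hg (by omega)]
    rcases s with - | s
    · rw [jet_coeff_eq_zero c (s := 0) (by simp) (by omega)]
      simp
    · rw [ih (s := s) _ (by omega), Nat.choose_succ_succ, ← Function.iterate_succ_apply]
      · push_cast
        ring
      · intro j hj
        rw [← Function.iterate_succ_apply]
        exact hg _ (by omega)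

theorem jet_eq_zero (c : K) {n s : ℕ} {g : regularAt c}
    (hg : ∀ j < s, evalAt c ((derivAt c)^[j] g) = 0) (h : n < s) : jet c n 0 g = 0 := by
  ext d
  rw [jet_coeff_eq_zero c hg (by omega), coeff_zero]

end Regular

/-! ### The derivation `∂_λ` on the elements that are linear in the `∂_λ^k e_λ` -/

section Lam

variable {K : Type*} [Field K]

theorem coeff_sum_monomial_map (c : K) (y : LamRing c) (s : ℕ →₀ ℕ) :
    (∑ t ∈ y.support, MvPolynomial.monomial t ((y.coeff t).map (derivAt c))).coeff s
      = (y.coeff s).map (derivAt c) := by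
  classical
  rw [MvPolynomial.coeff_sum]
  simp only [MvPolynomial.coeff_monomial]
  rw [Finset.sum_ite_eq']
  split_ifs with h
  · rfl
  · rw [MvPolynomial.notMem_support_iff.1 h]
    ext
    simp

theorem dLam_add (c : K) (y z : LamRing c) : dLam c (y + z) = dLam c y + dLam c z := by
  have : (∑ t ∈ (y + z).support, MvPolynomial.monomial t (((y + z).coeff t).map (derivAt c)))
      = (∑ t ∈ y.support, MvPolynomial.monomial t ((y.coeff t).map (derivAt c)))
        + (∑ t ∈ z.support, MvPolynomial.monomial t ((z.coeff t).map (derivAt c))) := by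
    refine MvPolynomial.ext _ _ fun s => ?_
    rw [MvPolynomial.coeff_add, coeff_sum_monomial_map, coeff_sum_monomial_map,
      coeff_sum_monomial_map, MvPolynomial.coeff_add]
    refine HahnSeries.ext (funext fun γ => ?_)
    simp
  rw [dLam, dLam, dLam, this, map_add]
  abel

/-- `∂_λ` as an additive map. -/
def dLamHom (c : K) : LamRing c →+ LamRing c := AddMonoidHom.mk' (dLam c) (dLam_add c)

theorem coe_dLamHom (c : K) : ⇑(dLamHom c) = dLam c := rfl

theorem dLam_C_mul_X (c : K) (f : HahnSeries ℚ (regularAt c)) (k : ℕ) :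
    dLam c (MvPolynomial.C f * MvPolynomial.X k) =
      MvPolynomial.C (f.map (derivAt c)) * MvPolynomial.X k
        + MvPolynomial.C f * MvPolynomial.X (k + 1) := by
  classical
  rw [dLam]
  congr 1
  · refine MvPolynomial.ext _ _ fun s => ?_
    rw [coeff_sum_monomial_map, MvPolynomial.coeff_C_mul, MvPolynomial.coeff_C_mul,
      MvPolynomial.coeff_X]
    refine HahnSeries.ext (funext fun γ => ?_)
    split_ifs <;> simp
  · rw [Derivation.leibniz, MvPolynomial.mkDerivation_X, ← MvPolynomial.algebraMap_eq,
      Derivation.map_algebraMap, smul_zero, add_zero, smul_eq_mul]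

theorem map_derivAt_mahler (p : ℕ) (hp : 2 ≤ p) (c : K) (f : HahnSeries ℚ (regularAt c)) :
    (mahler p hp (regularAt c) f).map (derivAt c)
      = mahler p hp (regularAt c) (f.map (derivAt c)) := by
  refine HahnSeries.ext (funext fun γ => ?_)
  rw [mahler_coeff, HahnSeries.map_coeff, HahnSeries.map_coeff, mahler_coeff]

theorem map_derivAt_const_mul (c : K) (b : HahnSeries ℚ K) (f : HahnSeries ℚ (regularAt c)) :
    (hahnMap (algebraMap K (regularAt c)) b * f).map (derivAt c)
      = hahnMap (algebraMap K (regularAt c)) b * f.map (derivAt c) := by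
  refine HahnSeries.ext (funext fun γ => ?_)
  -- Differentiation can shrink the support, so both products are expanded over the support of `f`
  -- to match term by term.
  have hsub : (f.map (derivAt c)).support ⊆ f.support := by
    intro γ hγ h0
    refine hγ ?_
    rw [HahnSeries.map_coeff, h0, map_zero]
  rw [HahnSeries.map_coeff, HahnSeries.coeff_mul, HahnSeries.coeff_mul_right' f.isPWO_support hsub,
    map_sum]
  refine Finset.sum_congr rfl fun ij _ => ?_
  rw [hahnMap_coeff, HahnSeries.map_coeff, ← Algebra.smul_def, ← Algebra.smul_def,
    Derivation.map_smul]

theorem map_derivAt_lam_mul (c : K) (f : HahnSeries ℚ (regularAt c)) :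
    (HahnSeries.C (lam c) * f).map (derivAt c)
      = HahnSeries.C (lam c) * f.map (derivAt c) + f := by
  refine HahnSeries.ext (funext fun γ => ?_)
  rw [HahnSeries.C_mul_eq_smul, HahnSeries.C_mul_eq_smul, HahnSeries.coeff_add,
    HahnSeries.map_coeff, HahnSeries.coeff_smul, HahnSeries.coeff_smul, HahnSeries.map_coeff,
    smul_eq_mul, Derivation.leibniz, derivAt_lam, smul_eq_mul, smul_eq_mul, mul_one]

/-- The elements that are linear in the `∂_λ^k e_λ`. -/
def linLam (c : K) : AddSubmonoid (LamRing c) :=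
  AddSubmonoid.closure (Set.range fun fk : HahnSeries ℚ (regularAt c) × ℕ =>
    MvPolynomial.C fk.1 * MvPolynomial.X fk.2)

theorem C_mul_X_mem_linLam (c : K) (f : HahnSeries ℚ (regularAt c)) (k : ℕ) :
    MvPolynomial.C f * MvPolynomial.X k ∈ linLam c :=
  AddSubmonoid.subset_closure ⟨(f, k), rfl⟩

theorem linLam_induction {c : K} {P : LamRing c → Prop} (h0 : P 0)
    (hadd : ∀ y z, P y → P z → P (y + z))
    (h : ∀ f k, P (MvPolynomial.C f * MvPolynomial.X k)) {y : LamRing c} (hy : y ∈ linLam c) :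
    P y := by
  induction hy using AddSubmonoid.closure_induction with
  | mem y hy =>
    obtain ⟨fk, rfl⟩ := hy
    exact h _ _
  | zero => exact h0
  | add y z _ _ hy hz => exact hadd y z hy hz

theorem C_mul_mem_linLam {c : K} (f : HahnSeries ℚ (regularAt c)) {y : LamRing c}
    (hy : y ∈ linLam c) : MvPolynomial.C f * y ∈ linLam c := by
  refine linLam_induction (P := fun y => MvPolynomial.C f * y ∈ linLam c) ?_ ?_ ?_ hy
  · rw [mul_zero]
    exact zero_mem _
  · intro y z hy hz
    rw [mul_add]
    exact add_mem hy hz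
  · intro g k
    rw [← mul_assoc, ← map_mul]
    exact C_mul_X_mem_linLam c _ _

theorem dLam_mem_linLam {c : K} {y : LamRing c} (hy : y ∈ linLam c) : dLam c y ∈ linLam c := by
  refine linLam_induction (P := fun y => dLam c y ∈ linLam c) ?_ ?_ ?_ hy
  · rw [← coe_dLamHom, map_zero]
    exact zero_mem _
  · intro y z hy hz
    rw [dLam_add]
    exact add_mem hy hz
  · intro g k
    rw [dLam_C_mul_X]
    exact add_mem (C_mul_X_mem_linLam c _ _) (C_mul_X_mem_linLam c _ _)

theorem phiLam_C_mul_X (p : ℕ) (hp : 2 ≤ p) (c : K) (f : HahnSeries ℚ (regularAt c)) (k : ℕ) :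
    phiLam p hp c (MvPolynomial.C f * MvPolynomial.X k) =
      MvPolynomial.C (HahnSeries.C (lam c) * mahler p hp (regularAt c) f) * MvPolynomial.X k
        + MvPolynomial.C (k • mahler p hp (regularAt c) f) * MvPolynomial.X (k - 1) := by
  simp only [phiLam, map_mul, MvPolynomial.eval₂Hom_C, MvPolynomial.eval₂Hom_X',
    RingHom.comp_apply, nsmul_eq_mul, map_natCast]
  ring

theorem phiLam_mem_linLam (p : ℕ) (hp : 2 ≤ p) {c : K} {y : LamRing c} (hy : y ∈ linLam c) :
    phiLam p hp c y ∈ linLam c := by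
  refine linLam_induction (P := fun y => phiLam p hp c y ∈ linLam c) ?_ ?_ ?_ hy
  · rw [map_zero]
    exact zero_mem _
  · intro y z hy hz
    rw [map_add]
    exact add_mem hy hz
  · intro g k
    rw [phiLam_C_mul_X]
    exact add_mem (C_mul_X_mem_linLam c _ _) (C_mul_X_mem_linLam c _ _)

theorem dLam_const_mul {c : K} (b : HahnSeries ℚ K) {y : LamRing c} (hy : y ∈ linLam c) :
    dLam c (MvPolynomial.C (hahnMap (algebraMap K (regularAt c)) b) * y)
      = MvPolynomial.C (hahnMap (algebraMap K (regularAt c)) b) * dLam c y := by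
  refine linLam_induction (P := fun y =>
    dLam c (MvPolynomial.C (hahnMap (algebraMap K (regularAt c)) b) * y)
      = MvPolynomial.C (hahnMap (algebraMap K (regularAt c)) b) * dLam c y) ?_ ?_ ?_ hy
  · rw [mul_zero, ← coe_dLamHom, map_zero, mul_zero]
  · intro y z hy hz
    rw [mul_add, dLam_add, dLam_add, hy, hz, mul_add]
  · intro f k
    rw [← mul_assoc, ← map_mul, dLam_C_mul_X, dLam_C_mul_X, map_derivAt_const_mul, map_mul,
      map_mul]
    ring

theorem map_derivAt_nsmul (c : K) (k : ℕ) (f : HahnSeries ℚ (regularAt c)) :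
    (k • f).map (derivAt c) = k • f.map (derivAt c) := by
  refine HahnSeries.ext (funext fun γ => ?_)
  rw [HahnSeries.map_coeff, HahnSeries.coeff_nsmul, HahnSeries.coeff_nsmul, Pi.smul_apply,
    Pi.smul_apply, map_nsmul, HahnSeries.map_coeff]

/-- Only elements linear in the `∂_λ^k e_λ` are needed, as `L`, `φ_p` and `∂_λ` preserve them; a
Leibniz rule for `dLam` on arbitrary products is thereby avoided. -/
theorem dLam_phiLam (p : ℕ) (hp : 2 ≤ p) {c : K} {y : LamRing c} (hy : y ∈ linLam c) :
    dLam c (phiLam p hp c y) = phiLam p hp c (dLam c y) := by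
  refine linLam_induction (P := fun y =>
    dLam c (phiLam p hp c y) = phiLam p hp c (dLam c y)) ?_ ?_ ?_ hy
  · rw [← coe_dLamHom, map_zero, map_zero, map_zero]
  · intro y z hy hz
    rw [map_add, dLam_add, dLam_add, map_add, hy, hz]
  · intro f k
    rw [dLam_C_mul_X, map_add, phiLam_C_mul_X, phiLam_C_mul_X, phiLam_C_mul_X, dLam_add,
      dLam_C_mul_X, dLam_C_mul_X, map_derivAt_lam_mul, map_derivAt_nsmul, map_derivAt_mahler]
    rcases k with - | k
    · simp
      ring
    · simp only [Nat.add_sub_cancel, map_add, map_mul, map_nsmul, add_mul, one_nsmul, add_smul,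
        smul_mul_assoc]
      ring

theorem opLam_mem_and_dLam (p : ℕ) (hp : 2 ≤ p) {m : ℕ} (a : Fin (m + 1) → HahnSeries ℚ K) {c : K}
    {y : LamRing c} (hy : y ∈ linLam c) : opLam p hp a c y ∈ linLam c ∧
      dLam c (opLam p hp a c y) = opLam p hp a c (dLam c y) := by
  have h : ∀ i : ℕ, (phiLam p hp c)^[i] y ∈ linLam c ∧
      dLam c ((phiLam p hp c)^[i] y) = (phiLam p hp c)^[i] (dLam c y) := by
    intro i
    induction i with
    | zero => exact ⟨hy, rfl⟩
    | succ i ih =>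
      rw [Function.iterate_succ_apply', Function.iterate_succ_apply', dLam_phiLam p hp ih.1, ih.2]
      exact ⟨phiLam_mem_linLam p hp ih.1, rfl⟩
  constructor
  · rw [opLam, mahlerOp]
    exact sum_mem fun i _ => C_mul_mem_linLam _ (h i).1
  · rw [opLam, mahlerOp, mahlerOp, ← coe_dLamHom, map_sum, coe_dLamHom]
    refine Finset.sum_congr rfl fun i _ => ?_
    rw [← (h i).2]
    exact dLam_const_mul _ (h i).1

theorem iterate_dLam_opLam (p : ℕ) (hp : 2 ≤ p) {m : ℕ} (a : Fin (m + 1) → HahnSeries ℚ K) {c : K}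
    (n : ℕ) {y : LamRing c} (hy : y ∈ linLam c) :
    (dLam c)^[n] (opLam p hp a c y) = opLam p hp a c ((dLam c)^[n] y) := by
  induction n generalizing y with
  | zero => rfl
  | succ n ih =>
    rw [Function.iterate_succ_apply, Function.iterate_succ_apply, (opLam_mem_and_dLam p hp a hy).2,
      ih (dLam_mem_linLam hy)]

/-! ### The specialisation at `λ = c` -/

theorem ev_C (c : Kˣ) (f : HahnSeries ℚ (regularAt (c : K))) :
    ev c (MvPolynomial.C f) = hahnToSolRing K (hahnMap (evalAt (c : K)) f) := by
  simp [ev]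

theorem ev_X (c : Kˣ) (k : ℕ) : ev c (MvPolynomial.X k) =
    algebraMap K (SolRing K) (((c : K) ^ k)⁻¹) *
      (∏ i ∈ Finset.range k, (ell K - (i : SolRing K))) * eConst c := by
  simp [ev]

theorem phi_hahn (p : ℕ) (hp : 2 ≤ p) (f : HahnSeries ℚ K) :
    phi p hp K (hahnToSolRing K f) = hahnToSolRing K (mahler p hp K f) := by
  change toSolRing K (phiPoly p hp K (MvPolynomial.C f)) = _
  rw [phiPoly, MvPolynomial.eval₂Hom_C]
  rfl

theorem algebraMap_solRing (r : K) :
    algebraMap K (SolRing K) r = hahnToSolRing K (HahnSeries.C r) := rfl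

theorem phi_algebraMap (p : ℕ) (hp : 2 ≤ p) (r : K) :
    phi p hp K (algebraMap K (SolRing K) r) = algebraMap K (SolRing K) r := by
  rw [algebraMap_solRing, phi_hahn, mahler, HahnSeries.embDomainRingHom_C]

theorem phi_eConst (p : ℕ) (hp : 2 ≤ p) (c : Kˣ) :
    phi p hp K (eConst c) = algebraMap K (SolRing K) c * eConst c := by
  change toSolRing K (phiPoly p hp K (MvPolynomial.X (some c))) = _
  rw [phiPoly, MvPolynomial.eval₂Hom_X', map_mul]
  rfl

theorem phi_ell (p : ℕ) (hp : 2 ≤ p) : phi p hp K (ell K) = ell K + 1 := by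
  change toSolRing K (phiPoly p hp K (MvPolynomial.X none)) = _
  rw [phiPoly, MvPolynomial.eval₂Hom_X', map_add, map_one]
  rfl

/-- The identity `(ℓ + 1)_k = (ℓ)_k + k (ℓ)_{k-1}` for falling factorials is the counterpart of `∂^k
(λ e_λ) = λ ∂^k e_λ + k ∂^(k-1) e_λ`. -/
theorem prod_add_one_sub {R : Type*} [CommRing R] (x : R) (k : ℕ) :
    ∏ i ∈ Finset.range k, (x + 1 - (i : R)) = ∏ i ∈ Finset.range k, (x - (i : R))
      + k * ∏ i ∈ Finset.range (k - 1), (x - (i : R)) := by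
  rcases k with - | k
  · simp
  · rw [Finset.prod_range_succ', Nat.add_sub_cancel, Finset.prod_range_succ]
    have : ∀ i ∈ Finset.range k, x + 1 - ((i + 1 : ℕ) : R) = x - i := fun i _ => by
      push_cast
      ring
    rw [Finset.prod_congr rfl this]
    push_cast
    ring

/-- The values `c^(-k) (ℓ)_k e_c` are made for this: `φ_p` multiplies `e_c` by `c`, and the extra
`c` turns `c^(-k)` into `c^(-(k-1))` in the second term. -/
theorem ev_phiLam (p : ℕ) (hp : 2 ≤ p) (c : Kˣ) (y : LamRing (c : K)) :
    ev c (phiLam p hp (c : K) y) = phi p hp K (ev c y) := by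
  rw [← RingHom.comp_apply, ← RingHom.comp_apply]
  congr 1
  refine MvPolynomial.ringHom_ext (fun f => ?_) (fun k => ?_)
  · rw [RingHom.comp_apply, RingHom.comp_apply, ev_C, phi_hahn, phiLam, MvPolynomial.eval₂Hom_C,
      RingHom.comp_apply, ev_C]
    congr 1
    refine HahnSeries.ext (funext fun γ => ?_)
    rw [hahnMap_coeff, mahler_coeff, mahler_coeff, hahnMap_coeff]
  · rw [RingHom.comp_apply, RingHom.comp_apply, ev_X, map_mul, map_mul, map_prod, phi_algebraMap,
      phi_eConst, phiLam, MvPolynomial.eval₂Hom_X', map_add, map_mul, map_mul, ev_C, ev_X, ev_X,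
      hahnMap_C, evalAt_lam, ← algebraMap_solRing, map_natCast]
    simp only [map_sub, phi_ell, map_natCast]
    rw [prod_add_one_sub]
    rcases k with - | k
    · simp
    · have hc : algebraMap K (SolRing K) (((c : K) ^ k)⁻¹)
          = algebraMap K (SolRing K) (((c : K) ^ (k + 1))⁻¹) * algebraMap K (SolRing K) c := by
        rw [← map_mul, pow_succ, mul_inv, mul_assoc, inv_mul_cancel₀ c.ne_zero, mul_one]
      rw [Nat.add_sub_cancel, hc]
      ring

theorem ev_opLam (p : ℕ) (hp : 2 ≤ p) {m : ℕ} (a : Fin (m + 1) → HahnSeries ℚ K) (c : Kˣ)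
    (y : LamRing (c : K)) : ev c (opLam p hp a (c : K) y)
      = mahlerOp (hahnToSolRing K) (phi p hp K) a (ev c y) := by
  have h : ∀ i : ℕ, ev c ((phiLam p hp (c : K))^[i] y) = (phi p hp K)^[i] (ev c y) := by
    intro i
    induction i with
    | zero => rfl
    | succ i ih => rw [Function.iterate_succ_apply', Function.iterate_succ_apply', ev_phiLam, ih]
  have h' : ∀ b : HahnSeries ℚ K,
      hahnMap (evalAt (c : K)) (hahnMap (algebraMap K (regularAt (c : K))) b) = b := by
    intro b
    refine HahnSeries.ext (funext fun γ => ?_)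
    rw [hahnMap_coeff, hahnMap_coeff, evalAt_algebraMap]
  simp only [opLam, mahlerOp, map_sum, map_mul, h, RingHom.comp_apply, ev_C, h']

/-- The recursion of `jet` copies the rule `∂(f ∂^k e_λ) = f' ∂^k e_λ + f ∂^(k+1) e_λ`; from here on
derivatives and specialisation are computed one coefficient at a time. -/
theorem coeff_solEmb_ev_iterate_dLam (c : Kˣ) (n k : ℕ) (f : HahnSeries ℚ (regularAt (c : K)))
    (γ : ℚ) :
    (solEmb K (ev c ((dLam (c : K))^[n] (MvPolynomial.C f * MvPolynomial.X k)))).coeff γ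
      = MonoidAlgebra.single c (jet (c : K) n k (f.coeff γ)) := by
  induction n generalizing f k with
  | zero =>
    have hprod : ∏ i ∈ Finset.range k, (HahnSeries.C (MonoidAlgebra.single (1 : Kˣ) (X : K[X]))
          - ((i : ℕ) : HahnSeries ℚ (ExpPoly K)))
        = HahnSeries.C (MonoidAlgebra.single 1 (∏ i ∈ Finset.range k, (X - C (i : K)))) := by
      have : HahnSeries.C (MonoidAlgebra.single 1 (∏ i ∈ Finset.range k, (X - C (i : K))))
          = ((HahnSeries.C (Γ := ℚ)).comp (MonoidAlgebra.singleOneRingHom (R := K[X]) (M := Kˣ)))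
            (∏ i ∈ Finset.range k, (X - C (i : K))) := rfl
      rw [this, map_prod]
      refine Finset.prod_congr rfl fun i _ => ?_
      rw [map_sub, C_eq_natCast, map_natCast]
      rfl
    rw [Function.iterate_zero_apply, map_mul, map_mul, ev_C, ev_X, map_mul, map_mul, map_prod,
      solEmb_hahn, solEmb_algebraMap, solEmb_eConst]
    simp only [map_sub, solEmb_ell, map_natCast]
    rw [hprod, ← map_mul, ← map_mul, mul_comm (hahnMap _ _), HahnSeries.C_mul_eq_smul, HahnSeries.coeff_smul,
      hahnMap_coeff, hahnMap_coeff, smul_eq_mul, mul_comm, ← Algebra.smul_def, ← Algebra.smul_def,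
      smul_mul_assoc, MonoidAlgebra.single_mul_single, smul_smul, MonoidAlgebra.smul_single, jet,
      smul_eq_C_mul, one_mul, mul_one]
  | succ n ih =>
    have h : (dLam (c : K))^[n] (MvPolynomial.C (f.map (derivAt (c : K))) * MvPolynomial.X k
        + MvPolynomial.C f * MvPolynomial.X (k + 1))
        = (dLam (c : K))^[n] (MvPolynomial.C (f.map (derivAt (c : K))) * MvPolynomial.X k)
          + (dLam (c : K))^[n] (MvPolynomial.C f * MvPolynomial.X (k + 1)) := by
      rw [← coe_dLamHom, iterate_map_add]
    rw [Function.iterate_succ_apply, dLam_C_mul_X, h, map_add, map_add, HahnSeries.coeff_add, ih,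
      ih, HahnSeries.map_coeff, ← MonoidAlgebra.single_add, jet]

/-- `ev_{λ = c}(∂_λ^n (h e_λ))` is a solution if `L (h e_λ)` is divisible by a higher power of
`λ - c`. -/
theorem mahlerOp_ev_iterate_dLam (p : ℕ) (hp : 2 ≤ p) {m : ℕ} (a : Fin (m + 1) → HahnSeries ℚ K)
    (c : Kˣ) {n s : ℕ} (hn : n < s) {f θ : HahnSeries ℚ (regularAt (c : K))}
    (h : opLam p hp a (c : K) (timesE f) = timesE (HahnSeries.C (unif (c : K) ^ s) * θ)) :
    mahlerOp (hahnToSolRing K) (phi p hp K) a (ev c ((dLam (c : K))^[n] (timesE f))) = 0 := by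
  -- The derivations are moved outside `L`, so that they act on the multiple of `(λ - c)^s`.
  rw [← ev_opLam, ← iterate_dLam_opLam p hp a n (y := timesE f) (C_mul_X_mem_linLam _ f 0), h]
  refine solEmb_injective (HahnSeries.ext (funext fun γ => ?_))
  rw [timesE, coeff_solEmb_ev_iterate_dLam, map_zero, HahnSeries.coeff_zero, jet_eq_zero _ _ hn,
    MonoidAlgebra.single_zero]
  intro j hj
  rw [HahnSeries.C_mul_eq_smul, HahnSeries.coeff_smul, smul_eq_mul]
  exact evalAt_iterate_derivAt_of_lt _ _ hj

end Lam

/-! ### Leading exponential polynomials of solutions -/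

section Solutions

variable {K : Type*} [Field K] {m : ℕ} {a : Fin (m + 1) → HahnSeries ℚ K}

/-- The term `a_j φ^j w` starts no lower than `val a_j + v p^j`, and the minimum over `j` is
attained exactly on the supporting line of slope `-v`; the coefficient of `L w` at this minimum is
the characteristic polynomial applied to the coefficient of `w` at `v`. -/
theorem aeval_charPoly_leading (p : ℕ) (hp : 2 ≤ p) (h0 : a 0 ≠ 0) {w : HahnSeries ℚ (ExpPoly K)}
    {v : ℚ} (hw : ∀ γ < v, w.coeff γ = 0)
    (h : mahlerOp (hahnMap (algebraMap K (ExpPoly K))) (hahnPhi p hp K) a w = 0) :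
    aeval (ExpPoly.sigma K).toLinearMap (charPoly p a (-v)) (w.coeff v) = 0 := by
  have hpos : ∀ j : ℕ, (0 : ℚ) < (p : ℚ) ^ j := fun j => pow_pos (Nat.cast_pos.2 (by omega)) j
  obtain ⟨i, hi⟩ := exists_onEdge p (-v) h0
  have hM := congrArg (HahnSeries.coeff · ((a i).order - -v * (p : ℚ) ^ (i : ℕ))) h
  simp only [mahlerOp, HahnSeries.coeff_sum, HahnSeries.coeff_zero] at hM
  rw [hi.charPoly_eq, map_sum, LinearMap.sum_apply, ← hM]
  refine Finset.sum_congr rfl fun j _ => ?_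
  have e : (a i).order - -v * (p : ℚ) ^ (i : ℕ)
      = ((a i).order - -v * (p : ℚ) ^ (i : ℕ) + -v * (p : ℚ) ^ (j : ℕ)) + v * (p : ℚ) ^ (j : ℕ) := by
    ring
  conv_rhs => rw [e]
  rw [coeff_mul_of_lower_bound, hahnMap_coeff, hahnPhi_coeff,
    mul_div_cancel_right₀ v (hpos j).ne', aeval_monomial, Module.End.mul_apply,
    Module.algebraMap_end_apply, Algebra.smul_def]
  · intro γ hγ
    rw [hahnMap_coeff, hi.coeff_eq_zero j hγ, map_zero]
  · intro γ hγ
    rw [hahnPhi_coeff, hw _ ((div_lt_iff₀ (hpos j)).2 hγ), map_zero]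

/-- The coefficient of `z^(-μ) e_c ℓ^i`, for the triple `t = (c, μ, i)`. -/
def leadCoeff (p : ℕ) (hp : 2 ≤ p) (a : Fin (m + 1) → HahnSeries ℚ K) (t : Idx p hp a) :
    SolRing K →ₗ[K] K where
  toFun y := (ExpPoly.comp t.1.1 ((solEmb K y).coeff (-t.1.2.1))).coeff t.1.2.2
  map_add' y z := by simp
  map_smul' r y := by simp [coeff_solEmb_smul]

theorem exists_leadCoeff_ne_zero [CharZero K] (p : ℕ) (hp : 2 ≤ p) (h0 : a 0 ≠ 0) {y : SolRing K}
    (hy : y ∈ solutions p hp a) (hne : y ≠ 0) : ∃ t, leadCoeff p hp a t y ≠ 0 := by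
  have hw : solEmb K y ≠ 0 := fun h => hne (solEmb_injective (h.trans (map_zero _).symm))
  set w := solEmb K y with hwdef
  have hL : mahlerOp (hahnMap (algebraMap K (ExpPoly K))) (hahnPhi p hp K) a w = 0 := by
    rw [hwdef, ← solEmb_mahlerOp, show mahlerOp _ _ a y = 0 from hy, map_zero]
  have hlead : w.coeff w.order ≠ 0 := by
    rw [← HahnSeries.leadingCoeff_eq]
    exact HahnSeries.leadingCoeff_ne_zero.2 hw
  obtain ⟨c, hc⟩ := ExpPoly.exists_comp_ne_zero hlead
  have haev := congrArg (ExpPoly.comp c) (aeval_charPoly_leading p hp h0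
    (fun γ hγ => HahnSeries.coeff_eq_zero_of_lt_order hγ) hL)
  rw [ExpPoly.comp_aeval_sigma, map_zero] at haev
  have hχ := charPoly_ne_zero p (-w.order) h0
  have hlt := natDegree_lt_rootMultiplicity c.ne_zero hχ hc haev
  have hroot : (charPoly p a (-w.order)).IsRoot (c : K) :=
    (rootMultiplicity_pos hχ).1 (Nat.zero_lt_of_lt hlt)
  -- The third index is the degree in `ℓ` of the `e_c`-component of the lowest coefficient.
  refine ⟨⟨(c, -w.order, _), ⟨mem_slopes_of_isRoot hp h0 c.ne_zero hroot, hroot⟩, hlt⟩, ?_⟩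
  change (ExpPoly.comp c (w.coeff (- -w.order))).coeff _ ≠ 0
  rw [neg_neg]
  exact leadingCoeff_ne_zero.2 hc

/-- A family of vectors is linearly independent if it is triangular with respect to a family of
linear forms. -/
theorem linearIndependent_of_triangular {ι V κ : Type*} [AddCommGroup V] [Module K V]
    [LinearOrder κ] (key : ι → κ) (f : ι → V →ₗ[K] K) (y : ι → V) (hdiag : ∀ t, f t (y t) ≠ 0)
    (hoff : ∀ t u, u ≠ t → key u ≤ key t → f t (y u) = 0) : LinearIndependent K y := by
  rw [linearIndependent_iff]
  intro l hl
  by_contra hne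
  obtain ⟨t, ht, hmax⟩ := Finset.exists_max_image l.support key (Finsupp.support_nonempty_iff.2 hne)
  have h := congrArg (f t) hl
  rw [Finsupp.linearCombination_apply, Finsupp.sum, map_sum, map_zero,
    Finset.sum_eq_single_of_mem t ht, map_smul, smul_eq_mul] at h
  · exact mul_ne_zero (Finsupp.mem_support_iff.1 ht) (hdiag t) h
  · intro u hu hut
    rw [map_smul, hoff t u hut (hmax u hu), smul_zero]

end Solutions

end MahlerFrobenius

end

/-! ### Independence and the dimension count -/

open MahlerFrobenius in
theorem mainTheorem10 {K : Type*} [Field K] [IsAlgClosed K] [CharZero K]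
    (p : ℕ) (hp : 2 ≤ p) (m : ℕ) (hm : 1 ≤ m)
    (a : Fin (m + 1) → HahnSeries ℚ K) (ha : ∀ i, IsPuiseux (a i))
    (ha_zero : a 0 ≠ 0) (ha_last : a (Fin.last m) ≠ 0)
    (h : ∀ c : Kˣ, ℚ → HahnSeries ℚ (regularAt (c : K)))
    (h_val : ∀ c μ, IsExponent p hp a c μ → (h c μ).orderTop = ((-μ : ℚ) : WithTop ℚ))
    (h_cld : ∀ c μ, IsExponent p hp a c μ →
      emultiplicity (lam (c : K) - algebraMap K (regularAt (c : K)) (c : K))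
        (h c μ).leadingCoeff = (multBelow p hp a c μ : ℕ∞))
    (h_op : ∀ c μ, IsExponent p hp a c μ → ∃ θ : HahnSeries ℚ (regularAt (c : K)),
      opLam p hp a (c : K) (timesE (h c μ)) =
        timesE (HahnSeries.C ((lam (c : K) - algebraMap K (regularAt (c : K)) (c : K)) ^
          (multBelow p hp a c μ + mult p a c μ)) * θ)) :
    Nat.card (Idx p hp a) = m ∧
    ∃ b : Module.Basis (Idx p hp a) K (solutions p hp a), ∀ t : Idx p hp a,
      (b t : SolRing K) =
        ev t.1.1 ((dLam (t.1.1 : K))^[multBelow p hp a t.1.1 t.1.2.1 + t.1.2.2]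
          (timesE (h t.1.1 t.1.2.1))) := by
  have hcard := card_idx hp ha_zero ha_last
  refine ⟨hcard, ?_⟩
  -- `Nat.card` is `0` on infinite types, so `m ≥ 1` yields finiteness.
  have hfin : Finite (Idx p hp a) := Nat.finite_of_card_ne_zero (by omega)
  have := Fintype.ofFinite (Idx p hp a)
  have hnonempty : Nonempty (Idx p hp a) := (Nat.card_pos_iff.1 (by omega)).1
  let y : Idx p hp a → solutions p hp a := fun t =>
    ⟨ev t.1.1 ((dLam (t.1.1 : K))^[multBelow p hp a t.1.1 t.1.2.1 + t.1.2.2]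
      (timesE (h t.1.1 t.1.2.1))), by
      obtain ⟨θ, hθ⟩ := h_op _ _ t.2.1
      exact mahlerOp_ev_iterate_dLam p hp a t.1.1 (Nat.add_lt_add_left t.2.2 _) hθ⟩
  let f : Idx p hp a → solutions p hp a →ₗ[K] K := fun t =>
    (leadCoeff p hp a t).comp (solutions p hp a).subtype
  have hcoeff : ∀ (u : Idx p hp a) (γ : ℚ), (solEmb K (y u : SolRing K)).coeff γ
      = MonoidAlgebra.single u.1.1 (jet (u.1.1 : K) (multBelow p hp a u.1.1 u.1.2.1 + u.1.2.2) 0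
        ((h u.1.1 u.1.2.1).coeff γ)) := fun u γ => coeff_solEmb_ev_iterate_dLam _ _ _ _ _
  have hval : ∀ (u : Idx p hp a) (γ : ℚ), γ < -u.1.2.1 → (h u.1.1 u.1.2.1).coeff γ = 0 := by
    intro u γ hγ
    refine HahnSeries.coeff_eq_zero_of_lt_orderTop ?_
    rw [h_val _ _ u.2.1]
    exact WithTop.coe_lt_coe.2 hγ
  have hlead : ∀ u : Idx p hp a,
      (∀ j < multBelow p hp a u.1.1 u.1.2.1,
        evalAt _ ((derivAt _)^[j] ((h u.1.1 u.1.2.1).coeff (-u.1.2.1))) = 0) ∧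
      evalAt _ ((derivAt _)^[multBelow p hp a u.1.1 u.1.2.1]
        ((h u.1.1 u.1.2.1).coeff (-u.1.2.1))) ≠ 0 := by
    intro u
    have hne : (h u.1.1 u.1.2.1).orderTop ≠ ⊤ := by simp [h_val _ _ u.2.1]
    have hlc : (h u.1.1 u.1.2.1).leadingCoeff = (h u.1.1 u.1.2.1).coeff (-u.1.2.1) := by
      rw [← HahnSeries.coeff_untop_eq_leadingCoeff hne]
      congr 1
      exact (WithTop.untop_eq_iff _).2 (h_val _ _ u.2.1)
    rw [← hlc]
    exact evalAt_iterate_derivAt_of_emultiplicity (h_cld _ _ u.2.1)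
  have hzero : ∀ (c : K) (n : ℕ), jet c n 0 0 = 0 := fun c n =>
    jet_eq_zero c (s := n + 1) (fun j _ => by simp [iterate_map_zero]) n.lt_succ_self
  have hli : LinearIndependent K y := by
    classical
    -- Lexicographic order on `(μ, i)`: a solution of smaller slope `μ` starts at a higher power
    -- `z^(-μ)`, and at equal slope a smaller `i` means a smaller degree in `ℓ`. No order on `c` is
    -- needed, since different `c` lie in different components.
    refine linearIndependent_of_triangular
      (fun t => (toLex (t.1.2.1, t.1.2.2) : ℚ ×ₗ ℕ)) f y ?_ ?_
    · intro t
      change (ExpPoly.comp t.1.1 ((solEmb K (y t : SolRing K)).coeff (-t.1.2.1))).coeff t.1.2.2 ≠ 0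
      rw [hcoeff, ExpPoly.comp_single, if_pos rfl, jet_coeff_eq _ (hlead t).1 (by omega)]
      exact mul_ne_zero (mul_ne_zero (Nat.cast_ne_zero.2 (Nat.choose_pos (by omega)).ne')
        (hlead t).2) (inv_ne_zero (pow_ne_zero _ t.1.1.ne_zero))
    · intro t u hut hle
      change (ExpPoly.comp t.1.1 ((solEmb K (y u : SolRing K)).coeff (-t.1.2.1))).coeff t.1.2.2 = 0
      rw [hcoeff, ExpPoly.comp_single]
      split_ifs with hc
      · rcases (Prod.Lex.toLex_le_toLex.1 hle) with hlt | ⟨heq, hle⟩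
        · rw [hval u _ (neg_lt_neg hlt), hzero, Polynomial.coeff_zero]
        · rcases hle.lt_or_eq with hlt | hi
          · dsimp only at heq hlt
            rw [← heq]
            exact jet_coeff_eq_zero _ (hlead u).1 (by omega)
          · exact absurd (Subtype.ext (Prod.ext hc (Prod.ext heq hi))) hut
      · exact Polynomial.coeff_zero _
  -- The coordinates indexed by the triples separate solutions, which bounds the dimension by their
  -- number.
  have hinj : Function.Injective (LinearMap.pi f) := by
    rw [← LinearMap.ker_eq_bot, LinearMap.ker_eq_bot']
    intro z hz
    by_contra hne
    obtain ⟨t, ht⟩ := exists_leadCoeff_ne_zero p hp ha_zero z.2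
      (fun h => hne (Subtype.ext h))
    exact ht (congrFun hz t)
  have hfd : FiniteDimensional K (solutions p hp a) := FiniteDimensional.of_injective _ hinj
  have hrank : Fintype.card (Idx p hp a) = Module.finrank K (solutions p hp a) := by
    refine le_antisymm hli.fintype_card_le_finrank ?_
    have := LinearMap.finrank_le_finrank_of_injective hinj
    rwa [Module.finrank_fintype_fun_eq_card] at this
  exact ⟨basisOfLinearIndependentOfCardEqFinrank hli hrank, fun t => by
    rw [coe_basisOfLinearIndependentOfCardEqFinrank]⟩
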